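/- For integers $n,m\ge 1$ let $\ell_1^m$ be $\mathbb R^m$ with the $\ell_1$-norm, the coordinatewise order and the standard basis $e_1,\dots,e_m$. For a symmetric tensor $\mathbf x\in(\ell_1^m)^{\otimes n}$ (invariant under all permutations of the $n$ factors) let $\|\mathbf x\|_\pi$ be its projective tensor norm and let $$\|\mathbf x\|_{\pi,s+}:=\inf\Bigl\{\sum_{k=1}^K |a_k|\,\|y_k\|^n:\ \mathbf x=\sum_{k=1}^K a_k\,y_k^{\otimes n},\ a_k\in\mathbb R,\ y_k\in\ell_1^m,\ y_k\ge 0\Bigr\},\qquad c_{\pi,s+}(n,\ell_1^m):=\sup_{\mathbf x}\frac{\|\mathbf x\|_{\pi,s+}}{\|\mathbf x\|_\pi},$$ the supremum being over all symmetric tensors $\mathbf x\in(\ell_1^m)^{\otimes n}$, with $0/0:=0$; every such $\mathbf x$ has a decomposition as in the infimum, and the supremum is finite. Let $$\kappa(n):=\Bigl\|\frac1{n!}\sum_{\sigma\in\mathfrak S_n}e_{\sigma(1)}\otimes\cdots\otimes e_{\sigma(n)}\Bigr\|_{\pi,s+}\quad\text{in }(\ell_1^n)^{\otimes n}.$$ For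 $N\ge n$ let $\chi_{n,N}\in(\ell_1^N)^{\otimes n}$ be the distribution of a vector obtained by drawing $n$ elements of $\{1,\dots,N\}$ without replacement, that is, the average of $e_{f(1)}\otimes\cdots\otimes e_{f(n)}$ over all injections $f:\{1,\dots,n\}\to\{1,\dots,N\}$. Let $\kappa(n,N):=\|\chi_{n,N}\|_{\pi,s+}$ and $$\kappa(n,N;m):=\max_{x\in\{1,\dots,m\}^N}\bigl\|\varphi_x^{\otimes n}(\chi_{n,N})\bigr\|_{\pi,s+},$$ where $\varphi_x:\ell_1^N\to\ell_1^m$ is the linear map with $\varphi_x(e_i)=e_{x_i}$. Theorem 7.3. Let $n,m,N\ge1$ be integers. (i) If $N>n(n-1)/2$, then $$\kappa(n,N)\le 1+\frac{n(n-1)}{2N-n(n-1)}\bigl(\kappa(n)+1\bigr).$$ (ii) If $N\ge n$, then $$\kappa(n,N)\ge \exp\Bigl(\frac{n-1}{2\lceil N/n\rceil}\Bigr)\ge 1+\frac{n(n-1)}{2(N+n)}.$$ (iii) If $N\ge n\ge m$, then $$\kappa(n,N;m)\le 1+c_{\pi,s+}(n,\ell_1^m)\,\frac{2mn}{N}\le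 1+\frac{2mn\,\kappa(n)}{N}.$$ (iv) If $N\ge n\ge m$, then $$\kappa(n,N;m)\ge \exp\Bigl(\frac{m-1}{2\lceil N/n\rceil}\Bigr)\ge 1+\frac{(m-1)n}{2(N+n)}.$$ In particular, for each fixed $n\ge 2$, $\kappa(n,N)=1+\Theta(1/N)$ as $N\to\infty$, while $\kappa(1,N)=1$ for every $N\ge1$. -/

import Mathlib

open scoped TensorProduct

namespace PosTensor

/-- The `n`-th algebraic tensor power `E ⊗ ⋯ ⊗ E` of a real vector space `E`. -/
abbrev TPow (n : ℕ) (E : Type*) [AddCommGroup E] [Module ℝ E] : Type _ :=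
  ⨂[ℝ] _ : Fin n, E

section General

variable {E : Type*} [NormedAddCommGroup E] [NormedSpace ℝ E]

/-- The subspace of symmetric tensors: those fixed by every permutation of the `n` factors. -/
def symTensors (n : ℕ) (E : Type*) [NormedAddCommGroup E] [NormedSpace ℝ E] :
    Submodule ℝ (TPow n E) where
  carrier := {x | ∀ σ : Equiv.Perm (Fin n), PiTensorProduct.reindex ℝ (fun _ => E) σ x = x}
  zero_mem' := fun σ => map_zero _
  add_mem' := fun hx hy σ => by rw [map_add, hx σ, hy σ]
  smul_mem' := fun c x hx σ => by rw [map_smul, hx σ]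

/-- The elementary symmetric tensor
`x₁ ∨ ⋯ ∨ xₙ = (1/n!) ∑_σ x_{σ(1)} ⊗ ⋯ ⊗ x_{σ(n)}`. -/
noncomputable def vee {n : ℕ} (x : Fin n → E) : TPow n E :=
  ((n.factorial : ℝ))⁻¹ •
    ∑ σ : Equiv.Perm (Fin n), PiTensorProduct.tprod ℝ (fun i => x (σ i))

/-- The costs `∑ₖ |aₖ| ‖yₖ‖ⁿ` of all decompositions `x = ∑ₖ aₖ yₖ ⊗ ⋯ ⊗ yₖ` of `x` into tensor
powers of elements `yₖ` of the positive cone `P` (with real coefficients `aₖ`). -/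
def symPosCosts (P : ConvexCone ℝ E) {n : ℕ} (x : TPow n E) : Set ℝ :=
  {r | ∃ (K : ℕ) (a : Fin K → ℝ) (y : Fin K → E),
    (∀ k, y k ∈ P) ∧
    x = ∑ k, a k • PiTensorProduct.tprod ℝ (fun _ : Fin n => y k) ∧
    r = ∑ k, |a k| * ‖y k‖ ^ n}

/-- The positive symmetric projective tensor norm `‖x‖_{π,s+}` of a symmetric tensor `x`
over a normed space ordered by the positive cone `P`. -/
noncomputable def symPosNorm (P : ConvexCone ℝ E) {n : ℕ} (x : TPow n E) : ℝ :=
  sInf (symPosCosts P x)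

/-- The ratio `‖x‖_{π,s+} / ‖x‖_π` of a symmetric tensor, where `‖·‖_π` is the projective tensor
norm; here `0 / 0 = 0`. -/
noncomputable def posRatio (P : ConvexCone ℝ E) (n : ℕ) (x : symTensors n E) : ℝ :=
  symPosNorm P (x : TPow n E) / PiTensorProduct.projectiveSeminorm (x : TPow n E)

/-- The positive polarization constant `c_{π,s+}(n, E)`: the supremum over symmetric tensors of
`‖x‖_{π,s+} / ‖x‖_π`. -/
noncomputable def posPolConst (P : ConvexCone ℝ E) (n : ℕ) : ℝ :=
  ⨆ x : symTensors n E, posRatio P n x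

end General

/-- The space `ℓ₁ᵐ`, i.e. `ℝᵐ` with the `ℓ₁`-norm. -/
abbrev EllOne (m : ℕ) : Type := PiLp 1 (fun _ : Fin m => ℝ)

/-- The cone of vectors in `ℓ₁ᵐ` with non-negative coordinates. -/
def posCone (m : ℕ) : ConvexCone ℝ (EllOne m) where
  carrier := {x | ∀ i, 0 ≤ x i}
  smul_mem' := fun c hc x hx i => by
    simpa using mul_nonneg hc.le (hx i)
  add_mem' := fun x hx y hy i => by
    simpa using add_nonneg (hx i) (hy i)

/-- The standard basis vector `eᵢ` of `ℓ₁ᵐ`. -/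
noncomputable def e {m : ℕ} (i : Fin m) : EllOne m := PiLp.single 1 i (1 : ℝ)

/-- `κ(n) = ‖e₁ ∨ ⋯ ∨ eₙ‖_{π,s+}` in `ℓ₁ⁿ`. -/
noncomputable def kappa (n : ℕ) : ℝ :=
  symPosNorm (posCone n) (vee (fun i : Fin n => (e i : EllOne n)))

/-- The tensor `χ_{n,N}` over `ℓ₁ᴺ`, i.e. the distribution of a vector obtained by drawing
`n` elements of `{1, …, N}` without replacement (a uniformly random injection
`{1, …, n} → {1, …, N}`). A distribution on `{1, …, N}ⁿ` is seen as a tensor by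
identifying the point mass at `(j₁, …, jₙ)` with `e_{j₁} ⊗ ⋯ ⊗ e_{jₙ}`. -/
noncomputable def chi (n N : ℕ) : TPow n (EllOne N) :=
  ((Fintype.card (Fin n ↪ Fin N) : ℝ))⁻¹ •
    ∑ f : Fin n ↪ Fin N, PiTensorProduct.tprod ℝ (fun i => (e (f i) : EllOne N))

/-- `χ_{n,N}` is also the image of `e₁ ∨ ⋯ ∨ e_N` under projection to the first `n` coordinates,
i.e. the distribution of the first `n` entries of a uniformly random permutation. -/
theorem chi_eq_perm {n N : ℕ} (h : n ≤ N) :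
    chi n N = ((N.factorial : ℝ))⁻¹ • ∑ σ : Equiv.Perm (Fin N),
      PiTensorProduct.tprod ℝ (fun i : Fin n => (e (σ (Fin.castLE h i)) : EllOne N)) := by
  classical
  set g : (Fin n → Fin N) → TPow n (EllOne N) :=
    fun f => PiTensorProduct.tprod ℝ (fun i => (e (f i) : EllOne N)) with hg
  set f₀ : Fin n ↪ Fin N := Fin.castLEEmb h with hf₀
  have key : ∀ f : Fin n ↪ Fin N,
      ∑ τ : Equiv.Perm (Fin N), g (τ ∘ f) = ∑ τ : Equiv.Perm (Fin N), g (τ ∘ f₀) := by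
    intro f
    obtain ⟨π, hπ⟩ : ∃ π : Equiv.Perm (Fin N), ∀ i, π (f₀ i) = f i := by
      let q : {x // x ∈ Set.range f₀} ≃ {x // x ∈ Set.range f} :=
        (Equiv.ofInjective f₀ f₀.injective).symm.trans (Equiv.ofInjective f f.injective)
      refine ⟨q.extendSubtype, fun i => ?_⟩
      rw [Equiv.extendSubtype_apply_of_mem q (f₀ i) ⟨i, rfl⟩]
      have : (⟨f₀ i, ⟨i, rfl⟩⟩ : {x // x ∈ Set.range f₀})
          = Equiv.ofInjective f₀ f₀.injective i := rfl
      rw [this]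
      simp [q]
    rw [← Equiv.sum_comp (Equiv.mulRight π) (fun τ : Equiv.Perm (Fin N) => g (τ ∘ f₀))]
    refine Finset.sum_congr rfl fun τ _ => congrArg g ?_
    funext i
    simp [hπ]
  have inv : ∀ τ : Equiv.Perm (Fin N),
      ∑ f : Fin n ↪ Fin N, g (τ ∘ f) = ∑ f : Fin n ↪ Fin N, g f := by
    intro τ
    rw [← Equiv.sum_comp (Equiv.embeddingCongr (Equiv.refl (Fin n)) τ)
      (fun f : Fin n ↪ Fin N => g f)]
    refine Finset.sum_congr rfl fun f _ => congrArg g ?_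
    funext i
    simp
  have hdouble : (N.factorial : ℝ) • ∑ f : Fin n ↪ Fin N, g f
      = (Fintype.card (Fin n ↪ Fin N) : ℝ) • ∑ τ : Equiv.Perm (Fin N), g (τ ∘ f₀) := by
    have h1 : ∑ τ : Equiv.Perm (Fin N), ∑ f : Fin n ↪ Fin N, g (τ ∘ f)
        = (N.factorial : ℝ) • ∑ f : Fin n ↪ Fin N, g f := by
      rw [Finset.sum_congr rfl fun τ _ => inv τ, Finset.sum_const, Finset.card_univ,
        Fintype.card_perm, Fintype.card_fin, Nat.cast_smul_eq_nsmul]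
    have h2 : ∑ f : Fin n ↪ Fin N, ∑ τ : Equiv.Perm (Fin N), g (τ ∘ f)
        = (Fintype.card (Fin n ↪ Fin N) : ℝ) • ∑ τ : Equiv.Perm (Fin N), g (τ ∘ f₀) := by
      rw [Finset.sum_congr rfl fun f _ => key f, Finset.sum_const, Finset.card_univ,
        Nat.cast_smul_eq_nsmul]
    rw [← h1, ← h2, Finset.sum_comm]
  have hN : (N.factorial : ℝ) ≠ 0 := by exact_mod_cast N.factorial_ne_zero
  have hc : (Fintype.card (Fin n ↪ Fin N) : ℝ) ≠ 0 := by
    have : Nonempty (Fin n ↪ Fin N) := ⟨f₀⟩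
    exact_mod_cast Fintype.card_ne_zero
  have : ∑ f : Fin n ↪ Fin N, g f = (N.factorial : ℝ)⁻¹ •
      (Fintype.card (Fin n ↪ Fin N) : ℝ) • ∑ τ : Equiv.Perm (Fin N), g (τ ∘ f₀) := by
    rw [← hdouble, inv_smul_smul₀ hN]
  change (Fintype.card (Fin n ↪ Fin N) : ℝ)⁻¹ • ∑ f : Fin n ↪ Fin N, g f
    = (N.factorial : ℝ)⁻¹ • ∑ τ : Equiv.Perm (Fin N), g (τ ∘ f₀)
  rw [this, smul_comm, inv_smul_smul₀ hc]

/-- `κ(n,N) = ‖χ_{n,N}‖_{π,s+}` in `ℓ₁ᴺ`. -/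
noncomputable def kappaExt (n N : ℕ) : ℝ :=
  symPosNorm (posCone N) (chi n N)

/-- For `x ∈ {1, …, m}ᴺ`, the linear map `φ_x : ℓ₁ᴺ → ℓ₁ᵐ` with `φ_x(eᵢ) = e_{xᵢ}`, i.e. the
push-forward of signed measures along `i ↦ xᵢ`. -/
noncomputable def phi {N m : ℕ} (x : Fin N → Fin m) : EllOne N →ₗ[ℝ] EllOne m :=
  (PiLp.basisFun 1 ℝ (Fin N)).constr ℝ (fun i => e (x i))

/-- `κ(n,N;m)`: the maximum over `x ∈ {1, …, m}ᴺ` of the norm `‖φ_x^{⊗n}(χ_{n,N})‖_{π,s+}` in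
`ℓ₁ᵐ` (a supremum over a finite set). -/
noncomputable def kappaExtFin (n N m : ℕ) : ℝ :=
  ⨆ x : Fin N → Fin m,
    symPosNorm (posCone m) (PiTensorProduct.map (fun _ : Fin n => phi x) (chi n N))

end PosTensor

/-! Upper bounds. Drawing with replacement is a tensor power of a probability vector, so its norm is
at most 1, and it remains to pay for the difference from drawing without replacement. Over `ℓ₁ᵐ` the
projective norm of a tensor is the `ℓ₁` norm of its coefficients. A symmetric tensor is the
combination of the tensors `e_{j₁} ∨ ⋯ ∨ e_{jₙ}` with these coefficients, and each of them is the
image of `e₁ ∨ ⋯ ∨ eₙ` under a positive contraction; hence a symmetric tensor costs at most `κ(n)`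
times its projective norm. For (i), let `p` be the probability that `n` uniform draws are distinct.
Then `u^{⊗n} = p χ + R`, where `R ≥ 0` is symmetric of mass `1 - p`; solving for `χ` gives `1 + (p⁻¹
- 1)(κ(n) + 1)`. For (iii), the two sampling schemes with `m` colours differ by at most `2mn/N` in
`ℓ₁` (Diaconis–Freedman, `prod_descFactorial_le`), and the symmetric difference is charged at rate
`c_{π,s+}`.

Lower bounds. The functional reading off the coefficient at `c` is, on `y^{⊗n}` with `y ≥ 0`, a
monomial, whose maximum on the simplex is known. Testing `χ_{n,nk}` with every colour of `c`
repeated `k` times gives `κ(n,nk;m) ≥ ∏ F(k,c_j) / F(k,n)`, where `F` is `fallingRatio`.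
Multiplicities `(1,…,1,n-m+1)` and concavity of the logarithm yield the exponential. General `N`
follows since `κ(n,N;m)` decreases in `N`, and (ii) is (iv) with `m = n` after merging colours. -/

namespace PosTensor

/-! ### The positive symmetric norm: triangle inequality, positive contractions, duality -/

section Costs

variable {E F : Type*} [NormedAddCommGroup E] [NormedSpace ℝ E]
  [NormedAddCommGroup F] [NormedSpace ℝ F] {P : ConvexCone ℝ E} {Q : ConvexCone ℝ F} {n : ℕ}

theorem zero_mem_symPosCosts : (0 : ℝ) ∈ symPosCosts P (0 : TPow n E) :=
  ⟨0, Fin.elim0, Fin.elim0, fun k => k.elim0, by simp, by simp⟩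

theorem add_mem_symPosCosts {x y : TPow n E} {r s : ℝ} (hr : r ∈ symPosCosts P x)
    (hs : s ∈ symPosCosts P y) : r + s ∈ symPosCosts P (x + y) := by
  obtain ⟨K, a, u, hu, rfl, rfl⟩ := hr
  obtain ⟨L, b, v, hv, rfl, rfl⟩ := hs
  refine ⟨K + L, Fin.append a b, Fin.append u v, fun k => ?_, ?_, ?_⟩
  · induction k using Fin.addCases with
    | left k => simpa using hu k
    | right k => simpa using hv k
  · simp [Fin.sum_univ_add]
  · simp [Fin.sum_univ_add]

theorem smul_mem_symPosCosts {x : TPow n E} {r : ℝ} (c : ℝ) (hr : r ∈ symPosCosts P x) :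
    |c| * r ∈ symPosCosts P (c • x) := by
  obtain ⟨K, a, u, hu, rfl, rfl⟩ := hr
  refine ⟨K, fun k => c * a k, u, hu, ?_, ?_⟩
  · simp only [Finset.smul_sum, mul_smul]
  · simp only [Finset.mul_sum, abs_mul, mul_assoc]

theorem pow_norm_mem_symPosCosts {y : E} (hy : y ∈ P) :
    ‖y‖ ^ n ∈ symPosCosts P (PiTensorProduct.tprod ℝ (fun _ : Fin n => y)) :=
  ⟨1, fun _ => 1, fun _ => y, fun _ => hy, by simp, by simp⟩

theorem nonneg_of_mem_symPosCosts {x : TPow n E} {r : ℝ} (hr : r ∈ symPosCosts P x) : 0 ≤ r := by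
  obtain ⟨K, a, u, hu, rfl, rfl⟩ := hr
  positivity

theorem symPosNorm_nonneg (x : TPow n E) : 0 ≤ symPosNorm P x :=
  Real.sInf_nonneg fun _ hr => nonneg_of_mem_symPosCosts hr

theorem symPosNorm_le_of_mem {x : TPow n E} {r : ℝ} (hr : r ∈ symPosCosts P x) :
    symPosNorm P x ≤ r :=
  csInf_le ⟨0, fun _ h => nonneg_of_mem_symPosCosts h⟩ hr

theorem symPosNorm_zero : symPosNorm P (0 : TPow n E) = 0 :=
  le_antisymm (symPosNorm_le_of_mem zero_mem_symPosCosts) (symPosNorm_nonneg _)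

theorem symPosNorm_tprod_le {y : E} (hy : y ∈ P) :
    symPosNorm P (PiTensorProduct.tprod ℝ (fun _ : Fin n => y)) ≤ ‖y‖ ^ n :=
  symPosNorm_le_of_mem (pow_norm_mem_symPosCosts hy)

/-- Nonemptiness cannot be dropped: a tensor without decomposition has norm `sInf ∅ = 0`. -/
theorem symPosNorm_add_le {x y : TPow n E} (hx : (symPosCosts P x).Nonempty)
    (hy : (symPosCosts P y).Nonempty) :
    symPosNorm P (x + y) ≤ symPosNorm P x + symPosNorm P y := by
  rw [← sub_le_iff_le_add]
  refine le_csInf hx fun r hr => ?_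
  rw [sub_le_comm]
  refine le_csInf hy fun s hs => ?_
  rw [sub_le_iff_le_add']
  exact symPosNorm_le_of_mem (add_mem_symPosCosts hr hs)

theorem symPosNorm_smul_le {x : TPow n E} (c : ℝ) (hx : (symPosCosts P x).Nonempty) :
    symPosNorm P (c • x) ≤ |c| * symPosNorm P x := by
  rcases eq_or_ne c 0 with rfl | hc
  · simp [symPosNorm_zero]
  · have hc' : 0 < |c| := abs_pos.2 hc
    rw [← div_le_iff₀' hc']
    refine le_csInf hx fun r hr => ?_
    rw [div_le_iff₀' hc']
    exact symPosNorm_le_of_mem (smul_mem_symPosCosts c hr)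

theorem nonempty_symPosCosts_smul {x : TPow n E} (c : ℝ) (hx : (symPosCosts P x).Nonempty) :
    (symPosCosts P (c • x)).Nonempty :=
  hx.imp' _ fun _ h => smul_mem_symPosCosts c h

theorem nonempty_symPosCosts_sum_smul {ι : Type*} (s : Finset ι) (c : ι → ℝ) {x : ι → TPow n E}
    (hx : ∀ i ∈ s, (symPosCosts P (x i)).Nonempty) :
    (symPosCosts P (∑ i ∈ s, c i • x i)).Nonempty := by
  classical
  induction s using Finset.induction_on with
  | empty => exact ⟨0, by simpa using zero_mem_symPosCosts⟩
  | insert i s hi ih =>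
    rw [Finset.sum_insert hi]
    obtain ⟨r, hr⟩ := nonempty_symPosCosts_smul (c i) (hx i (Finset.mem_insert_self i s))
    obtain ⟨t, ht⟩ := ih fun j hj => hx j (Finset.mem_insert_of_mem hj)
    exact ⟨_, add_mem_symPosCosts hr ht⟩

theorem symPosNorm_sum_smul_le {ι : Type*} (s : Finset ι) (c : ι → ℝ) {x : ι → TPow n E}
    (hx : ∀ i ∈ s, (symPosCosts P (x i)).Nonempty) :
    symPosNorm P (∑ i ∈ s, c i • x i) ≤ ∑ i ∈ s, |c i| * symPosNorm P (x i) := by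
  classical
  induction s using Finset.induction_on with
  | empty => simp [symPosNorm_zero]
  | insert i s hi ih =>
    have hi' := hx i (Finset.mem_insert_self i s)
    have hs' := fun j hj => hx j (Finset.mem_insert_of_mem hj)
    rw [Finset.sum_insert hi, Finset.sum_insert hi]
    exact (symPosNorm_add_le (nonempty_symPosCosts_smul _ hi')
      (nonempty_symPosCosts_sum_smul s c hs')).trans
        (add_le_add (symPosNorm_smul_le _ hi') (ih hs'))

theorem exists_mem_symPosCosts_map {T : E →ₗ[ℝ] F} (hT : ∀ y ∈ P, T y ∈ Q)
    (hT' : ∀ y ∈ P, ‖T y‖ ≤ ‖y‖) {x : TPow n E} {r : ℝ} (hr : r ∈ symPosCosts P x) :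
    ∃ s ∈ symPosCosts Q (PiTensorProduct.map (fun _ : Fin n => T) x), s ≤ r := by
  obtain ⟨K, a, u, hu, rfl, rfl⟩ := hr
  refine ⟨_, ⟨K, a, fun k => T (u k), fun k => hT _ (hu k), ?_, rfl⟩, ?_⟩
  · simp [map_sum]
  · exact Finset.sum_le_sum fun k _ => mul_le_mul_of_nonneg_left
      (pow_le_pow_left₀ (norm_nonneg _) (hT' _ (hu k)) n) (abs_nonneg _)

theorem nonempty_symPosCosts_map {T : E →ₗ[ℝ] F} (hT : ∀ y ∈ P, T y ∈ Q)
    (hT' : ∀ y ∈ P, ‖T y‖ ≤ ‖y‖) {x : TPow n E} (hx : (symPosCosts P x).Nonempty) :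
    (symPosCosts Q (PiTensorProduct.map (fun _ : Fin n => T) x)).Nonempty := by
  obtain ⟨r, hr⟩ := hx
  obtain ⟨s, hs, -⟩ := exists_mem_symPosCosts_map hT hT' hr
  exact ⟨s, hs⟩

theorem symPosNorm_map_le {T : E →ₗ[ℝ] F} (hT : ∀ y ∈ P, T y ∈ Q)
    (hT' : ∀ y ∈ P, ‖T y‖ ≤ ‖y‖) {x : TPow n E} (hx : (symPosCosts P x).Nonempty) :
    symPosNorm Q (PiTensorProduct.map (fun _ : Fin n => T) x) ≤ symPosNorm P x := by
  refine le_csInf hx fun r hr => ?_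
  obtain ⟨s, hs, hsr⟩ := exists_mem_symPosCosts_map hT hT' hr
  exact (symPosNorm_le_of_mem hs).trans hsr

/-- Duality: a linear functional that is at most `B ‖y‖ⁿ` in absolute value on the powers `y^{⊗n}`
of positive vectors is at most `B ‖x‖_{π,s+}` on `x`. -/
theorem apply_le_mul_symPosNorm (L : TPow n E →ₗ[ℝ] ℝ) {B : ℝ} (hB : 0 < B)
    (hL : ∀ y ∈ P, |L (PiTensorProduct.tprod ℝ fun _ => y)| ≤ B * ‖y‖ ^ n) {x : TPow n E}
    (hx : (symPosCosts P x).Nonempty) : L x ≤ B * symPosNorm P x := by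
  rw [← div_le_iff₀' hB]
  refine le_csInf hx fun r hr => ?_
  obtain ⟨K, a, u, hu, rfl, rfl⟩ := hr
  rw [div_le_iff₀' hB, map_sum, Finset.mul_sum]
  refine Finset.sum_le_sum fun k _ => ?_
  rw [map_smul, smul_eq_mul]
  refine (le_abs_self _).trans ?_
  rw [abs_mul, mul_left_comm]
  exact mul_le_mul_of_nonneg_left (hL _ (hu k)) (abs_nonneg _)

end Costs

end PosTensor

namespace PosTensor

/-! ### Polarization: `x₁ ∨ ⋯ ∨ xₙ` as a combination of powers of partial sums -/

section Polarization

variable {E : Type*} [NormedAddCommGroup E] [NormedSpace ℝ E] {P : ConvexCone ℝ E} {n : ℕ}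

/-- The polarization identity, by inclusion-exclusion. -/
theorem sum_perm_tprod_eq_sum_powerset (x : Fin n → E) :
    ∑ σ : Equiv.Perm (Fin n), PiTensorProduct.tprod ℝ (fun i => x (σ i)) =
      ∑ T : Finset (Fin n), (-1 : ℝ) ^ T.card •
        PiTensorProduct.tprod ℝ (fun _ : Fin n => ∑ i ∈ Tᶜ, x i) := by
  classical
  -- Expanding the power leaves the maps `f` whose image avoids `T`.
  have expand (T : Finset (Fin n)) :
      PiTensorProduct.tprod ℝ (fun _ : Fin n => ∑ i ∈ Tᶜ, x i) =
        ∑ f : Fin n → Fin n, if T ⊆ (Finset.univ.image f)ᶜ then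
          PiTensorProduct.tprod ℝ (fun i => x (f i)) else 0 := by
    rw [MultilinearMap.map_sum_finset, ← Finset.sum_filter]
    refine Finset.sum_congr ?_ fun _ _ => rfl
    ext f
    simp only [Fintype.mem_piFinset, Finset.mem_compl, Finset.mem_filter, Finset.mem_univ,
      true_and, Finset.subset_iff, Finset.mem_image, not_exists]
    exact ⟨fun h a ha i hi => h i (hi ▸ ha), fun h i hi => h hi i rfl⟩
  -- The alternating sum over the subsets of the complement of the image vanishes unless that
  -- complement is empty, that is, unless `f` is a permutation.
  have coef (f : Fin n → Fin n) :
      (∑ T : Finset (Fin n), if T ⊆ (Finset.univ.image f)ᶜ then (-1 : ℝ) ^ T.card else 0) =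
        if Function.Bijective f then 1 else 0 := by
    have h := congrArg (Int.cast : ℤ → ℝ)
      (Finset.sum_powerset_neg_one_pow_card (x := (Finset.univ.image f)ᶜ))
    push_cast at h
    rw [← Finset.sum_filter]
    convert h using 2
    · ext T; simp
    · rw [Finset.compl_eq_empty_iff, ← Finite.surjective_iff_bijective,
        Finset.eq_univ_iff_forall]
      simp [Function.Surjective]
  simp only [expand, Finset.smul_sum]
  rw [Finset.sum_comm]
  have (f : Fin n → Fin n) : (∑ T : Finset (Fin n), (-1 : ℝ) ^ T.card •
      if T ⊆ (Finset.univ.image f)ᶜ then PiTensorProduct.tprod ℝ (fun i => x (f i)) else 0) =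
      if Function.Bijective f then PiTensorProduct.tprod ℝ (fun i => x (f i)) else 0 := by
    rw [← one_smul ℝ (PiTensorProduct.tprod ℝ (fun i => x (f i))), ← ite_zero_smul, ← coef f,
      Finset.sum_smul]
    refine Finset.sum_congr rfl fun T _ => ?_
    split_ifs <;> simp
  rw [Finset.sum_congr rfl fun f _ => this f, ← Finset.sum_filter]
  exact Finset.sum_bij (fun σ _ => σ)
    (fun σ _ => Finset.mem_filter.2 ⟨Finset.mem_univ _, σ.bijective⟩) (by simp [DFunLike.coe_fn_eq])
    (fun f hf => ⟨Equiv.ofBijective f (Finset.mem_filter.1 hf).2, by simp, rfl⟩) (by simp)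

theorem nonempty_symPosCosts_vee {x : Fin n → E} (h : ∀ T : Finset (Fin n), ∑ i ∈ T, x i ∈ P) :
    (symPosCosts P (vee x)).Nonempty := by
  rw [vee, sum_perm_tprod_eq_sum_powerset]
  exact nonempty_symPosCosts_smul _ (nonempty_symPosCosts_sum_smul _ _
    fun T _ => ⟨_, pow_norm_mem_symPosCosts (h _)⟩)

end Polarization

/-! ### Tensors over `ℓ₁ᵐ`: coefficients, projective norm, and comparison with `κ(n)` -/

section EllOne

variable {m n : ℕ}

theorem e_apply (i j : Fin m) : (e i : EllOne m) j = if j = i then 1 else 0 :=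
  PiLp.single_apply 1 ℝ i 1 j

theorem norm_e (i : Fin m) : ‖(e i : EllOne m)‖ = 1 := by
  simp [e]

theorem sum_apply_smul_e (y : EllOne m) : ∑ k, y k • (e k : EllOne m) = y := by
  simpa [e] using (PiLp.basisFun 1 ℝ (Fin m)).sum_repr y

theorem norm_eq_sum_of_mem {y : EllOne m} (hy : y ∈ posCone m) : ‖y‖ = ∑ i, y i := by
  rw [PiLp.norm_eq_of_L1]
  exact Finset.sum_congr rfl fun i _ => Real.norm_of_nonneg (hy i)

theorem sum_e_mem (s : Finset (Fin m)) : ∑ i ∈ s, (e i : EllOne m) ∈ posCone m := by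
  intro j
  rw [WithLp.ofLp_sum, Finset.sum_apply]
  refine Finset.sum_nonneg fun i _ => ?_
  rw [e_apply]
  split_ifs <;> norm_num

/-- The linear functional that reads off the coefficient of `e_{j₁} ⊗ ⋯ ⊗ e_{jₙ}`. -/
noncomputable def coeff (j : Fin n → Fin m) : TPow n (EllOne m) →ₗ[ℝ] ℝ :=
  PiTensorProduct.lift ((MultilinearMap.mkPiAlgebra ℝ (Fin n) ℝ).compLinearMap
    fun i => PiLp.projₗ 1 (fun _ : Fin m => ℝ) (j i))

theorem coeff_tprod (j : Fin n → Fin m) (y : Fin n → EllOne m) :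
    coeff j (PiTensorProduct.tprod ℝ y) = ∏ i, y i (j i) := by
  simp [coeff]

theorem coeff_tprod_e (j f : Fin n → Fin m) :
    coeff j (PiTensorProduct.tprod ℝ fun i => (e (f i) : EllOne m)) = if f = j then 1 else 0 := by
  rw [coeff_tprod]
  simp only [e_apply, Finset.prod_ite_zero, Finset.prod_const_one, Finset.mem_univ, true_imp_iff,
    funext_iff, eq_comm]

theorem sum_coeff_smul (x : TPow n (EllOne m)) :
    ∑ j, coeff j x • PiTensorProduct.tprod ℝ (fun i => (e (j i) : EllOne m)) = x := by
  induction x using PiTensorProduct.induction_on with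
  | smul_tprod r y =>
    conv_rhs => rw [← funext fun i => sum_apply_smul_e (y i), MultilinearMap.map_sum]
    rw [Finset.smul_sum]
    refine Finset.sum_congr rfl fun j _ => ?_
    rw [MultilinearMap.map_smul_univ, map_smul, coeff_tprod, smul_assoc]
  | add x y hx hy => simp only [map_add, add_smul, Finset.sum_add_distrib, hx, hy]

/-- The `ℓ₁` norm of the coefficients is subadditive and multiplicative on elementary tensors, so it
is bounded by the cost of every representation. With the reverse bound from the basis expansion, it
is the projective norm. -/
theorem sum_abs_coeff_le (x : TPow n (EllOne m)) :
    ∑ j, |coeff j x| ≤ PiTensorProduct.projectiveSeminorm x := by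
  have key (l : List (ℝ × (Fin n → EllOne m))) :
      ∑ j, |coeff j (l.map fun p => p.1 • PiTensorProduct.tprod ℝ p.2).sum| ≤
        (l.map fun p => ‖p.1‖ * ∏ i, ‖p.2 i‖).sum := by
    induction l with
    | nil => simp
    | cons p l ih =>
      simp only [List.map_cons, List.sum_cons, map_add, map_smul, coeff_tprod]
      refine (Finset.sum_le_sum fun j _ => abs_add_le _ _).trans ?_
      rw [Finset.sum_add_distrib]
      refine add_le_add (le_of_eq ?_) ih
      simp only [smul_eq_mul, abs_mul, Finset.abs_prod, PiLp.norm_eq_of_L1, Real.norm_eq_abs]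
      rw [← Finset.mul_sum, Finset.prod_univ_sum, Fintype.piFinset_univ]
  refine le_ciInf fun p => ?_
  have hp := (PiTensorProduct.mem_lifts_iff x p.1).1 p.2
  conv_lhs => rw [← hp]
  exact key _

theorem projectiveSeminorm_le_sum_abs_coeff (x : TPow n (EllOne m)) :
    PiTensorProduct.projectiveSeminorm x ≤ ∑ j, |coeff j x| := by
  conv_lhs => rw [← sum_coeff_smul x]
  refine (norm_sum_le (E := TPow n (EllOne m)) _ _).trans (Finset.sum_le_sum fun j _ => ?_)
  rw [norm_smul, Real.norm_eq_abs]
  refine mul_le_of_le_one_right (abs_nonneg _) ?_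
  exact (PiTensorProduct.projectiveSeminorm_tprod_le _).trans (by simp [norm_e])

theorem phi_e {N : ℕ} (x : Fin N → Fin m) (i : Fin N) : phi x (e i) = e (x i) := by
  have := (PiLp.basisFun 1 ℝ (Fin N)).constr_basis ℝ (fun i => (e (x i) : EllOne m)) i
  rwa [PiLp.basisFun_apply] at this

theorem phi_eq_sum {N : ℕ} (x : Fin N → Fin m) (y : EllOne N) :
    phi x y = ∑ i, y i • e (x i) := by
  conv_lhs => rw [← sum_apply_smul_e y]
  simp [phi_e]

theorem phi_mem {N : ℕ} (x : Fin N → Fin m) : ∀ y ∈ posCone N, phi x y ∈ posCone m := by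
  intro y hy j
  rw [phi_eq_sum, WithLp.ofLp_sum, Finset.sum_apply]
  refine Finset.sum_nonneg fun i _ => ?_
  rw [PiLp.smul_apply, e_apply]
  have := hy i
  split_ifs <;> simp [this]

theorem norm_phi_le {N : ℕ} (x : Fin N → Fin m) : ∀ y ∈ posCone N, ‖phi x y‖ ≤ ‖y‖ := by
  intro y _
  rw [phi_eq_sum, PiLp.norm_eq_of_L1 y]
  refine (norm_sum_le _ _).trans (le_of_eq ?_)
  simp [norm_smul, norm_e]

theorem map_phi_tprod_e {N : ℕ} (x : Fin N → Fin m) (f : Fin n → Fin N) :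
    PiTensorProduct.map (fun _ : Fin n => phi x)
      (PiTensorProduct.tprod ℝ fun i => (e (f i) : EllOne N)) =
    PiTensorProduct.tprod ℝ fun i => (e (x (f i)) : EllOne m) := by
  simp [phi_e]

theorem map_phi_vee {N : ℕ} (x : Fin N → Fin m) (f : Fin n → Fin N) :
    PiTensorProduct.map (fun _ : Fin n => phi x) (vee fun i => (e (f i) : EllOne N)) =
      vee fun i => (e (x (f i)) : EllOne m) := by
  simp [vee, phi_e]

theorem nonempty_symPosCosts_vee_e (j : Fin n → Fin m) :
    (symPosCosts (posCone m) (vee fun i => (e (j i) : EllOne m))).Nonempty := by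
  have h := map_phi_vee j (id : Fin n → Fin n)
  simp only [id] at h
  rw [← h]
  exact nonempty_symPosCosts_map (phi_mem j) (norm_phi_le j) (nonempty_symPosCosts_vee sum_e_mem)

/-- Repeating indices only helps: `phi j` is a positive contraction carrying `e₁ ∨ ⋯ ∨ eₙ` to this
tensor. -/
theorem symPosNorm_vee_e_le (j : Fin n → Fin m) :
    symPosNorm (posCone m) (vee fun i => (e (j i) : EllOne m)) ≤ kappa n := by
  have h := map_phi_vee j (id : Fin n → Fin n)
  simp only [id] at h
  rw [← h]
  exact symPosNorm_map_le (phi_mem j) (norm_phi_le j) (nonempty_symPosCosts_vee sum_e_mem)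

theorem kappa_nonneg (n : ℕ) : 0 ≤ kappa n := symPosNorm_nonneg _

/-- The basis expansion is averaged over all permutations of the factors, which fix `x`. -/
theorem eq_sum_coeff_smul_vee {x : TPow n (EllOne m)} (hx : x ∈ symTensors n (EllOne m)) :
    x = ∑ j, coeff j x • vee fun i => (e (j i) : EllOne m) := by
  have h (σ : Equiv.Perm (Fin n)) :
      ∑ j, coeff j x • PiTensorProduct.tprod ℝ (fun i => (e (j (σ i)) : EllOne m)) = x := by
    conv_rhs => rw [← hx σ.symm, ← sum_coeff_smul x, map_sum]
    refine Finset.sum_congr rfl fun j _ => ?_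
    rw [map_smul, PiTensorProduct.reindex_tprod]
    rfl
  have h' : ∑ σ : Equiv.Perm (Fin n), ∑ j : Fin n → Fin m,
      coeff j x • PiTensorProduct.tprod ℝ (fun i => (e (j (σ i)) : EllOne m)) =
        (n.factorial : ℝ) • x := by
    rw [Finset.sum_congr rfl fun σ _ => h σ, Finset.sum_const, Finset.card_univ,
      Fintype.card_perm, Fintype.card_fin, Nat.cast_smul_eq_nsmul]
  rw [Finset.sum_comm] at h'
  simp only [vee, smul_comm _ ((n.factorial : ℝ))⁻¹]
  simp only [← Finset.smul_sum] at h' ⊢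
  rw [h', inv_smul_smul₀ (by positivity)]

theorem nonempty_symPosCosts {x : TPow n (EllOne m)} (hx : x ∈ symTensors n (EllOne m)) :
    (symPosCosts (posCone m) x).Nonempty := by
  rw [eq_sum_coeff_smul_vee hx]
  exact nonempty_symPosCosts_sum_smul _ _ fun j _ => nonempty_symPosCosts_vee_e j

theorem symPosNorm_le_sum_abs_coeff {x : TPow n (EllOne m)} (hx : x ∈ symTensors n (EllOne m)) :
    symPosNorm (posCone m) x ≤ kappa n * ∑ j, |coeff j x| := by
  conv_lhs => rw [eq_sum_coeff_smul_vee hx]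
  refine (symPosNorm_sum_smul_le _ _ fun j _ => nonempty_symPosCosts_vee_e j).trans ?_
  rw [Finset.mul_sum]
  refine Finset.sum_le_sum fun j _ => ?_
  rw [mul_comm]
  exact mul_le_mul_of_nonneg_right (symPosNorm_vee_e_le j) (abs_nonneg _)

theorem posRatio_le_kappa (x : symTensors n (EllOne m)) : posRatio (posCone m) n x ≤ kappa n :=
  div_le_of_le_mul₀ (apply_nonneg _ _) (kappa_nonneg n)
    ((symPosNorm_le_sum_abs_coeff x.2).trans
      (mul_le_mul_of_nonneg_left (sum_abs_coeff_le _) (kappa_nonneg n)))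

theorem bddAbove_range_posRatio : BddAbove (Set.range (posRatio (posCone m) n)) :=
  ⟨kappa n, Set.forall_mem_range.2 posRatio_le_kappa⟩

theorem posPolConst_le_kappa : posPolConst (posCone m) n ≤ kappa n :=
  ciSup_le posRatio_le_kappa

theorem posPolConst_nonneg : 0 ≤ posPolConst (posCone m) n :=
  Real.iSup_nonneg fun _ => div_nonneg (symPosNorm_nonneg _) (apply_nonneg _ _)

theorem symPosNorm_le_posPolConst_mul {x : TPow n (EllOne m)} (hx : x ∈ symTensors n (EllOne m)) :
    symPosNorm (posCone m) x ≤ posPolConst (posCone m) n * ∑ j, |coeff j x| := by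
  have h := le_ciSup (bddAbove_range_posRatio (m := m) (n := n)) ⟨x, hx⟩
  have hπ := projectiveSeminorm_le_sum_abs_coeff x
  -- Here `‖x‖` is the projective seminorm. If it is zero, the ratio says nothing; but then all
  -- coefficients vanish.
  rcases (norm_nonneg x).eq_or_lt with h0 | h0
  · have h1 := symPosNorm_le_sum_abs_coeff hx
    rw [le_antisymm ((sum_abs_coeff_le x).trans h0.ge) (by positivity), mul_zero] at h1
    exact h1.trans (mul_nonneg posPolConst_nonneg (by positivity))
  · exact ((div_le_iff₀ h0).1 h).trans (mul_le_mul_of_nonneg_left hπ posPolConst_nonneg)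

end EllOne

end PosTensor

namespace PosTensor

/-! ### Falling factorials, and hypergeometric against multinomial probabilities -/

section FallingFactorial

/-- The union bound over the `n(n-1)/2` pairs of draws, each colliding with probability `1/N`,
cleared of denominators. -/
theorem pow_mul_le_descFactorial {N : ℕ} (hN : 1 ≤ N) (n : ℕ) :
    (N : ℝ) ^ n * (2 * N - n * (n - 1)) ≤ 2 * N * N.descFactorial n := by
  induction n with
  | zero => simp
  | succ n ih =>
    have hN' : (1 : ℝ) ≤ N := by exact_mod_cast hN
    rcases le_or_gt N n with h | h
    · have h' : (N : ℝ) ≤ n := by exact_mod_cast h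
      have : (2 * N - ((n + 1 : ℕ) : ℝ) * ((n + 1 : ℕ) - 1) : ℝ) ≤ 0 := by
        push_cast; nlinarith
      exact (mul_nonpos_of_nonneg_of_nonpos (by positivity) this).trans (by positivity)
    · rw [Nat.descFactorial_succ]
      push_cast [h.le]
      have h' : (n : ℝ) ≤ N := by exact_mod_cast h.le
      have hn : (0 : ℝ) ≤ n ^ 2 * (n - 1) := by
        rcases Nat.eq_zero_or_pos n with rfl | hn
        · simp
        · have : (1 : ℝ) ≤ n := by exact_mod_cast hn
          exact mul_nonneg (by positivity) (by linarith)
      have h1 := mul_le_mul_of_nonneg_left ih (sub_nonneg.2 h')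
      have h2 : (0 : ℝ) ≤ N ^ n * (n ^ 2 * (n - 1)) := by positivity
      rw [pow_succ]
      nlinarith

/-- This is `(1 + 1/A)^(A+1) ≥ e`, from `(1 - 1/(A+1))^(A+1) ≤ e⁻¹`. -/
theorem exp_mul_pow_le_succ_pow (A : ℕ) :
    Real.exp 1 * (A : ℝ) ^ (A + 1) ≤ ((A : ℝ) + 1) ^ (A + 1) := by
  have hA : (0 : ℝ) < (A : ℝ) + 1 := by positivity
  have h := Real.add_one_le_exp (-(1 / ((A : ℝ) + 1)))
  have h1 : (A : ℝ) / (A + 1) ≤ Real.exp (-(1 / ((A : ℝ) + 1))) := by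
    convert h using 1; field_simp; ring
  have h2 := pow_le_pow_left₀ (by positivity) h1 (A + 1)
  rw [← Real.exp_nat_mul, div_pow, div_le_iff₀ (by positivity)] at h2
  have h3 : ((A + 1 : ℕ) : ℝ) * -(1 / ((A : ℝ) + 1)) = -1 := by push_cast; field_simp
  rw [h3, Real.exp_neg] at h2
  rwa [← le_inv_mul_iff₀ (Real.exp_pos 1)]

theorem succ_pow_le_exp_mul_pow (A : ℕ) :
    ((A : ℝ) + 1) ^ A ≤ Real.exp 1 * (A : ℝ) ^ A := by
  rcases Nat.eq_zero_or_pos A with rfl | hA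
  · simp
  have hA' : (0 : ℝ) < A := by exact_mod_cast hA
  have h := pow_le_pow_left₀ (by positivity) (Real.add_one_le_exp (1 / (A : ℝ))) A
  rw [← Real.exp_nat_mul, mul_one_div_cancel hA'.ne'] at h
  calc ((A : ℝ) + 1) ^ A = (1 / (A : ℝ) + 1) ^ A * (A : ℝ) ^ A := by
        rw [← mul_pow]; congr 1; field_simp; ring
    _ ≤ _ := by gcongr

/-- The bound is proved for all `q > 0`, because the induction on `a` rescales `q` by a factor
greater than 1. -/
theorem descFactorial_succ_mul_pow_le (b a : ℕ) {q : ℝ} (hq : 0 < q) :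
    ((a + b + 1).descFactorial (a + 1) : ℝ) * q ^ (b + 1) ≤
      ((a : ℝ) + b + 1) ^ (a + 1) * Real.exp ((a + b + 1) * (q - 1)) := by
  induction a generalizing q with
  | zero =>
    have h : q ≤ Real.exp (q - 1) := by simpa using Real.add_one_le_exp (q - 1)
    have h1 := pow_le_pow_left₀ hq.le h (b + 1)
    rw [← Real.exp_nat_mul] at h1
    push_cast at h1
    simp only [zero_add, Nat.descFactorial_one, Nat.cast_zero, pow_one]
    push_cast
    gcongr
  | succ a ih =>
    set A : ℕ := a + b + 1 with hA
    have hA0 : (0 : ℝ) < A := by positivity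
    have hAc : (a : ℝ) + b + 1 = A := by rw [hA]; push_cast; ring
    -- With this choice the exponent becomes `(A+1)(q-1) + 1`; the spare factor `e` is absorbed by
    -- `h3`.
    have h := ih (q := (A + 1) * q / A) (by positivity)
    have h3 := exp_mul_pow_le_succ_pow A
    have e1 : (a + 1 + b + 1).descFactorial (a + 1 + 1) = (A + 1) * A.descFactorial (a + 1) := by
      rw [← Nat.succ_descFactorial_succ]; congr 1; omega
    have e2 : ((a + 1 : ℕ) : ℝ) + b + 1 = A + 1 := by rw [← hAc]; push_cast; ring
    rw [e1, e2]
    rw [hAc, show (A : ℝ) * ((A + 1) * q / A - 1) = (A + 1) * (q - 1) + 1 by field_simp; ring,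
      Real.exp_add, div_pow, mul_pow, mul_div_assoc', div_le_iff₀ (by positivity)] at h
    have e3 : (A : ℝ) ^ (A + 1) = (A : ℝ) ^ (a + 1) * (A : ℝ) ^ (b + 1) := by
      rw [← pow_add]; congr 1; omega
    have e4 : ((A : ℝ) + 1) ^ (A + 1) = ((A : ℝ) + 1) ^ (a + 1) * ((A : ℝ) + 1) ^ (b + 1) := by
      rw [← pow_add]; congr 1; omega
    rw [e3, e4] at h3
    have h4 : (A.descFactorial (a + 1) : ℝ) * q ^ (b + 1) ≤
        ((A : ℝ) + 1) ^ (a + 1) * Real.exp ((A + 1) * (q - 1)) := by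
      have hp : (0 : ℝ) < ((A : ℝ) + 1) ^ (b + 1) := by positivity
      refine le_of_mul_le_mul_right ?_ hp
      have h5 := mul_le_mul_of_nonneg_left h3 (Real.exp_pos ((A + 1) * (q - 1))).le
      linarith
    push_cast
    rw [pow_succ ((A : ℝ) + 1) (a + 1)]
    have := mul_le_mul_of_nonneg_left h4 (show (0 : ℝ) ≤ (A : ℝ) + 1 by positivity)
    linarith

theorem descFactorial_mul_pow_le {a A : ℕ} (h : a ≤ A) {q : ℝ} (hq : 0 < q) (hq1 : q ≤ 1) :
    (A.descFactorial a : ℝ) * q ^ (A - a + 1) ≤ (A : ℝ) ^ a * Real.exp (A * (q - 1)) := by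
  obtain ⟨b, rfl⟩ := Nat.exists_eq_add_of_le h
  rw [Nat.add_sub_cancel_left]
  cases a with
  | zero =>
    have h : q ≤ Real.exp (q - 1) := by simpa using Real.add_one_le_exp (q - 1)
    have h1 := pow_le_pow_left₀ hq.le h b
    rw [← Real.exp_nat_mul] at h1
    simp only [Nat.descFactorial_zero, Nat.cast_one, one_mul, pow_zero, zero_add, pow_succ]
    exact (mul_le_of_le_one_right (by positivity) hq1).trans h1
  | succ a =>
    have := descFactorial_succ_mul_pow_le b a hq
    rw [show a + 1 + b = a + b + 1 by omega]
    push_cast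
    exact this

/-- Equivalently, `N^N e^(-N) / N!` decreases in `N`: each step uses `(1 + 1/A)^A ≤ e`. -/
theorem pow_le_descFactorial_mul_pow (B n : ℕ) :
    ((n : ℝ) + B) ^ (n + B) ≤ ((n + B).descFactorial n : ℝ) * (B : ℝ) ^ B * Real.exp n := by
  induction n with
  | zero => simp
  | succ n ih =>
    have h := succ_pow_le_exp_mul_pow (n + B)
    rw [show n + 1 + B = n + B + 1 by omega, Nat.succ_descFactorial_succ]
    push_cast at h ⊢
    rw [show (n : ℝ) + 1 + B = n + B + 1 by ring, pow_succ, Real.exp_add]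
    have h1 : ((n : ℝ) + B + 1) ^ (n + B) ≤
        Real.exp 1 * (((n + B).descFactorial n : ℝ) * (B : ℝ) ^ B * Real.exp n) :=
      h.trans (by gcongr)
    have := mul_le_mul_of_nonneg_left h1 (show (0 : ℝ) ≤ (n : ℝ) + B + 1 by positivity)
    linarith

/-- Comparison of the multivariate hypergeometric probabilities with the multinomial ones. -/
theorem prod_descFactorial_le {ι : Type*} [Fintype ι] [Nonempty ι] (c A : ι → ℕ) :
    ((∑ j, A j : ℕ) : ℝ) ^ (∑ j, c j) *
      ((1 - ((∑ j, c j : ℕ) : ℝ) / (∑ j, A j : ℕ)) ^ Fintype.card ι *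
        ∏ j, ((A j).descFactorial (c j) : ℝ)) ≤
      ((∑ j, A j).descFactorial (∑ j, c j) : ℝ) * ∏ j, (A j : ℝ) ^ c j := by
  by_cases hc : ∀ j, c j ≤ A j
  swap
  · push Not at hc
    obtain ⟨j, hj⟩ := hc
    rw [Finset.prod_eq_zero (Finset.mem_univ j) (by
      rw [Nat.descFactorial_eq_zero_iff_lt.2 hj, Nat.cast_zero]), mul_zero, mul_zero]
    positivity
  set N := ∑ j, A j with hN
  set n := ∑ j, c j with hn
  obtain ⟨B, hB⟩ := Nat.exists_eq_add_of_le (Finset.sum_le_sum fun j (_ : j ∈ Finset.univ) => hc j)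
  rw [← hN, ← hn] at hB
  -- If `B = N - n = 0` and `N > 0`, then `1 - n/N = 0` and the left side vanishes, as there is at
  -- least one colour. If `N = 0`, then `0 / 0 = 0` and both sides are 1.
  rcases Nat.eq_zero_or_pos B with rfl | hB0
  · rcases Nat.eq_zero_or_pos N with h0 | h0
    · have hA0 : ∀ j, A j = 0 := fun j =>
        (Finset.sum_eq_zero_iff.1 (hN.symm.trans h0)) j (Finset.mem_univ j)
      have hc0 : ∀ j, c j = 0 := fun j => Nat.le_zero.1 ((hc j).trans (hA0 j).le)
      simp [hn, hc0, h0]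
    · have h1 : (n : ℝ) / N = 1 := by
        rw [hB, add_zero] at h0 ⊢
        exact div_self (by positivity)
      rw [h1, sub_self, zero_pow Fintype.card_ne_zero, zero_mul, mul_zero]
      positivity
  · have hN0 : (0 : ℝ) < N := by rw [hB]; positivity
    set q : ℝ := 1 - (n : ℝ) / N with hq
    have hqB : q = (B : ℝ) / N := by
      rw [hq]; field_simp; rw [hB]; push_cast; ring
    have hq0 : 0 < q := by rw [hqB]; positivity
    have hq1 : q ≤ 1 := by rw [hq]; linarith [show (0 : ℝ) ≤ (n : ℝ) / N by positivity]
    -- The value `q = B/N` makes the product of the colour bounds match the bound `h2` for the whole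
    -- population: the exponents of `q` add up to `B` plus one per colour, and the exponentials
    -- multiply to `e^(-n)`. The surplus of one per colour is the loss factor in the statement.
    have h1 : ∏ j, (((A j).descFactorial (c j) : ℝ) * q ^ (A j - c j + 1)) ≤
        ∏ j, ((A j : ℝ) ^ c j * Real.exp (A j * (q - 1))) :=
      Finset.prod_le_prod (fun j _ => by positivity)
        fun j _ => descFactorial_mul_pow_le (hc j) hq0 hq1
    rw [Finset.prod_mul_distrib, Finset.prod_mul_distrib, Finset.prod_pow_eq_pow_sum,
      ← Real.exp_sum, ← Finset.sum_mul, ← Nat.cast_sum, ← hN] at h1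
    have e1 : ∑ j, (A j - c j + 1) = B + Fintype.card ι := by
      rw [Finset.sum_add_distrib, Finset.sum_tsub_distrib _ fun j _ => hc j, ← hN, ← hn, hB]
      simp
    rw [e1, pow_add] at h1
    have h2 := pow_le_descFactorial_mul_pow B n
    have e2 : (n : ℝ) + B = N := by rw [hB]; push_cast; ring
    rw [← hB, e2] at h2
    have e3 : (N : ℝ) * (q - 1) = -n := by rw [hq]; field_simp; ring
    rw [e3] at h1
    have hBq : (B : ℝ) ^ B = q ^ B * (N : ℝ) ^ B := by
      rw [hqB, ← mul_pow, div_mul_cancel₀ _ hN0.ne']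
    rw [hBq, hB, pow_add, ← hB] at h2
    have h3 : (N : ℝ) ^ n ≤ (N.descFactorial n : ℝ) * q ^ B * Real.exp n := by
      refine le_of_mul_le_mul_right ?_ (show (0 : ℝ) < (N : ℝ) ^ B by positivity)
      linarith
    refine le_of_mul_le_mul_right ?_ (show (0 : ℝ) < q ^ B by positivity)
    calc _ = (N : ℝ) ^ n * ((∏ j, ((A j).descFactorial (c j) : ℝ)) *
            (q ^ B * q ^ Fintype.card ι)) := by ring
      _ ≤ (N.descFactorial n : ℝ) * q ^ B * Real.exp n *
            ((∏ j, (A j : ℝ) ^ c j) * Real.exp (-n)) :=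
          mul_le_mul h3 h1 (by positivity) (by positivity)
      _ = (N.descFactorial n : ℝ) * q ^ B * (∏ j, (A j : ℝ) ^ c j) *
            (Real.exp n * Real.exp (-n)) := by ring
      _ = _ := by rw [← Real.exp_add, add_neg_cancel, Real.exp_zero]; ring

end FallingFactorial

/-! ### Growth of the ratio `F(k,s) / F(k,s+d)` -/

section FallingRatio

/-- The probability that `a` independent uniform draws from a set of `k a` elements are distinct. -/
noncomputable def fallingRatio (k a : ℕ) : ℝ :=
  ∏ i ∈ Finset.range a, (1 - (i : ℝ) / (k * a))

theorem descFactorial_eq_fallingRatio {k : ℕ} (hk : 1 ≤ k) (a : ℕ) :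
    ((k * a).descFactorial a : ℝ) = fallingRatio k a * ((k : ℝ) * a) ^ a := by
  rcases Nat.eq_zero_or_pos a with rfl | ha
  · simp [fallingRatio]
  have hk' : (0 : ℝ) < k := by exact_mod_cast hk
  have ha' : (0 : ℝ) < a := by exact_mod_cast ha
  rw [Nat.descFactorial_eq_prod_range, fallingRatio, Nat.cast_prod]
  conv_rhs => rw [← Finset.card_range a, ← Finset.prod_const, Finset.card_range]
  rw [← Finset.prod_mul_distrib]
  refine Finset.prod_congr rfl fun i hi => ?_
  rw [Nat.cast_sub ((Finset.mem_range.1 hi).le.trans (Nat.le_mul_of_pos_left a hk))]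
  push_cast
  field_simp

theorem one_sub_div_pos {k a i : ℕ} (hk : 1 ≤ k) (hi : i < a) :
    (0 : ℝ) < 1 - (i : ℝ) / (k * a) := by
  have hk' : (1 : ℝ) ≤ k := by exact_mod_cast hk
  have hi' : (i : ℝ) < a := by exact_mod_cast hi
  have hi0 : (0 : ℝ) ≤ i := by positivity
  rw [sub_pos, div_lt_one (by nlinarith)]
  nlinarith

theorem fallingRatio_pos {k : ℕ} (hk : 1 ≤ k) (a : ℕ) : 0 < fallingRatio k a :=
  Finset.prod_pos fun _ hi => one_sub_div_pos hk (Finset.mem_range.1 hi)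

theorem log_fallingRatio {k : ℕ} (hk : 1 ≤ k) (a : ℕ) :
    Real.log (fallingRatio k a) = ∑ i ∈ Finset.range a, Real.log (1 - (i : ℝ) / (k * a)) :=
  Real.log_prod fun _ hi => (one_sub_div_pos hk (Finset.mem_range.1 hi)).ne'

/-- On the left each `Y j` with `0 < j < c` has total weight `(1 - j/a) + (j-1)/a = 1 - 1/a`; only
the end terms differ. -/
theorem sum_range_interpolate {a : ℝ} {Y : ℕ → ℝ} (hY : Y 0 = 0) (c : ℕ) :
    ∑ i ∈ Finset.range c, ((1 - i / a) * Y i + i / a * Y (i + 1)) =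
      (1 - 1 / a) * ∑ i ∈ Finset.range c, Y i + (c - 1) / a * Y c := by
  induction c with
  | zero => simp [hY]
  | succ c ih =>
    rw [Finset.sum_range_succ, ih, Finset.sum_range_succ]
    push_cast
    ring

/-- Concavity of `log` gives `log F(k,a) ≥ (1 - 1/a) log F(k,a+1)`, and `log t ≤ t - 1` gives `log
F(k,a+1) ≤ -a/(2k)`. Together the logarithm drops by at least `1/(2k)`. -/
theorem exp_mul_fallingRatio_succ_le {k a : ℕ} (hk : 1 ≤ k) (ha : 1 ≤ a) :
    Real.exp (1 / (2 * k)) * fallingRatio k (a + 1) ≤ fallingRatio k a := by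
  have hk' : (0 : ℝ) < k := by exact_mod_cast hk
  have ha' : (0 : ℝ) < a := by exact_mod_cast ha
  set X : ℕ → ℝ := fun j => 1 - (j : ℝ) / (k * (a + 1 : ℕ)) with hX
  have hXpos : ∀ j < a + 1, 0 < X j := fun j hj => one_sub_div_pos hk hj
  have hlog : Real.log (fallingRatio k (a + 1)) = ∑ j ∈ Finset.range (a + 1), Real.log (X j) :=
    log_fallingRatio hk _
  have h1 : (1 - 1 / (a : ℝ)) * Real.log (fallingRatio k (a + 1)) ≤
      Real.log (fallingRatio k a) := by
    rw [hlog, log_fallingRatio hk a, Finset.sum_range_succ, mul_add]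
    have e : (1 - 1 / (a : ℝ)) = (a - 1) / a := by field_simp
    have hY := sum_range_interpolate (a := a) (Y := fun j => Real.log (X j)) (by simp [hX]) a
    rw [← e] at hY
    rw [← hY]
    refine Finset.sum_le_sum fun i hi => ?_
    have hi' := Finset.mem_range.1 hi
    have hi'' : (i : ℝ) ≤ a := by exact_mod_cast hi'.le
    have h0 : (0 : ℝ) ≤ 1 - i / a := sub_nonneg.2 ((div_le_one ha').2 hi'')
    have h0' : (0 : ℝ) ≤ i / a := by positivity
    -- The point `i/a` is the average of `i/(a+1)` and `(i+1)/(a+1)` with weights `1 - i/a` and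
    -- `i/a`.
    have := strictConcaveOn_log_Ioi.concaveOn.2 (hXpos i (by omega)) (hXpos (i + 1) (by omega))
      h0 h0' (by ring)
    simp only [smul_eq_mul] at this
    convert this using 2
    simp only [hX]
    push_cast
    field_simp
    ring
  have h2 : Real.log (fallingRatio k (a + 1)) ≤ -(a / (2 * k)) := by
    rw [hlog]
    calc _ ≤ ∑ j ∈ Finset.range (a + 1), -((j : ℝ) / (k * (a + 1 : ℕ))) := by
          refine Finset.sum_le_sum fun j hj => ?_
          have := Real.log_le_sub_one_of_pos (hXpos j (Finset.mem_range.1 hj))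
          simp only [hX] at this ⊢
          linarith
      _ = _ := by
          have hs := Finset.sum_range_id_mul_two (a + 1)
          have hs' : (∑ j ∈ Finset.range (a + 1), (j : ℝ)) * 2 = (a + 1) * a := by
            rw [Nat.add_sub_cancel] at hs
            have := congrArg (Nat.cast : ℕ → ℝ) hs
            push_cast at this
            exact this
          rw [Finset.sum_neg_distrib, ← Finset.sum_div]
          congr 1
          push_cast
          field_simp
          linarith
  have h3 : 1 / (2 * (k : ℝ)) + Real.log (fallingRatio k (a + 1)) ≤
      Real.log (fallingRatio k a) := by
    have : 1 / (2 * (k : ℝ)) ≤ -(1 / (a : ℝ)) * Real.log (fallingRatio k (a + 1)) := by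
      have := mul_le_mul_of_nonneg_left h2 (show (0 : ℝ) ≤ 1 / a by positivity)
      have e : 1 / (a : ℝ) * -(a / (2 * k)) = -(1 / (2 * k)) := by field_simp
      linarith
    linarith
  rw [← Real.exp_log (fallingRatio_pos hk a), ← Real.exp_log (fallingRatio_pos hk (a + 1)),
    ← Real.exp_add]
  exact Real.exp_le_exp.2 h3

theorem exp_mul_fallingRatio_le {k s : ℕ} (hk : 1 ≤ k) (hs : 1 ≤ s) (d : ℕ) :
    Real.exp (d / (2 * k)) * fallingRatio k (s + d) ≤ fallingRatio k s := by
  induction d with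
  | zero => simp
  | succ d ih =>
    refine le_trans ?_ ih
    have := exp_mul_fallingRatio_succ_le hk (show 1 ≤ s + d by omega)
    push_cast
    rw [add_div, Real.exp_add, mul_assoc, ← add_assoc]
    gcongr

end FallingRatio

end PosTensor

namespace PosTensor

/-! ### Counting injections that respect colourings -/

section Counting

/-- Embeddings compatible with two colourings, split into one embedding for each colour. -/
def embeddingFiberEquiv {α β γ : Type*} (z : α → γ) (x : β → γ) :
    {f : α ↪ β // ∀ i, x (f i) = z i} ≃ ∀ j, {i // z i = j} ↪ {b // x b = j} where
  toFun f j := ⟨fun i => ⟨f.1 i, (f.2 i).trans i.2⟩, fun i i' h =>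
    Subtype.ext (f.1.injective (congrArg Subtype.val h))⟩
  invFun g := ⟨⟨fun i => (g (z i) ⟨i, rfl⟩).1, fun i i' h => by
    have key : ∀ j (hj : z i' = j), (g j ⟨i', hj⟩).1 = (g (z i') ⟨i', rfl⟩).1 := by
      rintro j rfl; rfl
    have hz : z i' = z i := by
      rw [← (g (z i') ⟨i', rfl⟩).2, ← (g (z i) ⟨i, rfl⟩).2]
      exact congrArg x h.symm
    have h' : (g (z i) ⟨i, rfl⟩).1 = (g (z i) ⟨i', hz⟩).1 := h.trans (key _ hz).symm
    exact congrArg Subtype.val ((g (z i)).injective (Subtype.ext h'))⟩,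
    fun i => (g (z i) ⟨i, rfl⟩).2⟩
  left_inv f := rfl
  right_inv g := by
    funext j
    ext ⟨i, rfl⟩
    rfl

theorem card_embedding_fiber {α β γ : Type*} [Fintype α] [Fintype β] [Fintype γ] [DecidableEq α]
    [DecidableEq β] [DecidableEq γ] (z : α → γ) (x : β → γ) :
    Fintype.card {f : α ↪ β // ∀ i, x (f i) = z i} =
      ∏ j, (Fintype.card {b // x b = j}).descFactorial (Fintype.card {i // z i = j}) := by
  rw [Fintype.card_congr (embeddingFiberEquiv z x), Fintype.card_pi]
  simp only [Fintype.card_embedding_eq]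

theorem prod_comp_eq_prod_pow_card {α γ : Type*} [Fintype α] [Fintype γ] [DecidableEq γ]
    (z : α → γ) (f : γ → ℝ) : ∏ i, f (z i) = ∏ j, f j ^ Fintype.card {i // z i = j} := by
  rw [← Finset.prod_fiberwise' Finset.univ z f]
  simp only [Finset.prod_const, Fintype.card_subtype]

theorem sum_card_fiber {α γ : Type*} [Fintype α] [Fintype γ] [DecidableEq γ] (z : α → γ) :
    ∑ j, Fintype.card {i // z i = j} = Fintype.card α := by
  rw [← Fintype.card_sigma]
  exact Fintype.card_congr (Equiv.sigmaFiberEquiv z)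

end Counting

/-! ### Coefficients of `φ_x^{⊗n}(χ_{n,N})` and monotonicity in `N` -/

section Chi

variable {n N m : ℕ}

theorem chi_mem_symTensors (n N : ℕ) : chi n N ∈ symTensors n (EllOne N) := by
  intro σ
  rw [chi, map_smul, map_sum, ← Equiv.sum_comp (Equiv.embeddingCongr σ.symm (Equiv.refl (Fin N)))]
  congr 1
  refine Finset.sum_congr rfl fun f _ => ?_
  rw [PiTensorProduct.reindex_tprod]
  simp

theorem tprod_const_mem_symTensors {E : Type*} [NormedAddCommGroup E] [NormedSpace ℝ E] (y : E) :
    PiTensorProduct.tprod ℝ (fun _ : Fin n => y) ∈ symTensors n E :=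
  fun σ => PiTensorProduct.reindex_tprod σ _

theorem map_mem_symTensors {E F : Type*} [NormedAddCommGroup E] [NormedSpace ℝ E]
    [NormedAddCommGroup F] [NormedSpace ℝ F] (T : E →ₗ[ℝ] F) {x : TPow n E}
    (hx : x ∈ symTensors n E) :
    PiTensorProduct.map (fun _ : Fin n => T) x ∈ symTensors n F := fun σ => by
  rw [← PiTensorProduct.map_reindex (fun _ => T) σ x, hx σ]

theorem map_phi_chi (x : Fin N → Fin m) :
    PiTensorProduct.map (fun _ : Fin n => phi x) (chi n N) = (N.descFactorial n : ℝ)⁻¹ •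
      ∑ f : Fin n ↪ Fin N, PiTensorProduct.tprod ℝ (fun i => (e (x (f i)) : EllOne m)) := by
  rw [chi, map_smul, map_sum, Fintype.card_embedding_eq, Fintype.card_fin, Fintype.card_fin]
  simp only [map_phi_tprod_e]

theorem coeff_map_phi_chi (x : Fin N → Fin m) (z : Fin n → Fin m) :
    coeff z (PiTensorProduct.map (fun _ : Fin n => phi x) (chi n N)) =
      (N.descFactorial n : ℝ)⁻¹ * ∏ j, ((Fintype.card {b // x b = j}).descFactorial
        (Fintype.card {i // z i = j}) : ℝ) := by
  rw [map_phi_chi, map_smul, map_sum, smul_eq_mul]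
  simp only [fun f : Fin n ↪ Fin N => coeff_tprod_e z fun i => x (f i)]
  rw [Finset.sum_boole, ← Nat.cast_prod, ← card_embedding_fiber z x, Fintype.card_subtype]
  simp only [funext_iff]

theorem sum_coeff_tprod (y : Fin n → EllOne m) :
    ∑ z, coeff z (PiTensorProduct.tprod ℝ y) = ∏ i, ∑ j, y i j := by
  simp only [coeff_tprod]
  rw [Finset.prod_univ_sum, Fintype.piFinset_univ]

theorem sum_e_apply (i : Fin m) : ∑ j, (e i : EllOne m) j = 1 := by
  simp [e_apply]

theorem sum_coeff_map_phi_chi (h : n ≤ N) (x : Fin N → Fin m) :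
    ∑ z, coeff z (PiTensorProduct.map (fun _ : Fin n => phi x) (chi n N)) = 1 := by
  have hD : (N.descFactorial n : ℝ) ≠ 0 := by
    exact_mod_cast (Nat.descFactorial_pos.2 h).ne'
  rw [map_phi_chi]
  simp only [map_smul, map_sum, smul_eq_mul]
  rw [← Finset.mul_sum, Finset.sum_comm]
  simp only [fun f : Fin n ↪ Fin N => sum_coeff_tprod fun i => (e (x (f i)) : EllOne m),
    sum_e_apply, Finset.prod_const_one, Finset.sum_const, Finset.card_univ,
    Fintype.card_embedding_eq, Fintype.card_fin, nsmul_eq_mul, mul_one]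
  exact inv_mul_cancel₀ hD

theorem symPosNorm_map_phi_chi_le_kappaExtFin (x : Fin N → Fin m) :
    symPosNorm (posCone m) (PiTensorProduct.map (fun _ : Fin n => phi x) (chi n N)) ≤
      kappaExtFin n N m :=
  le_ciSup (f := fun x : Fin N → Fin m =>
    symPosNorm (posCone m) (PiTensorProduct.map (fun _ : Fin n => phi x) (chi n N)))
    (Set.finite_range _).bddAbove x

theorem kappaExtFin_le_kappaExt (hm : 1 ≤ m) : kappaExtFin n N m ≤ kappaExt n N := by
  have : Nonempty (Fin m) := ⟨⟨0, hm⟩⟩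
  exact ciSup_le fun x => symPosNorm_map_le (phi_mem x) (norm_phi_le x)
    (nonempty_symPosCosts (chi_mem_symTensors n N))

/-- Drawing without replacement from a large set amounts to drawing without replacement from a
uniformly random subset. -/
theorem map_phi_chi_eq_average {N' : ℕ} (h : n ≤ N) (h' : N ≤ N') (x : Fin N' → Fin m) :
    PiTensorProduct.map (fun _ : Fin n => phi x) (chi n N') =
      ∑ σ : Equiv.Perm (Fin N'), ((N'.factorial : ℝ))⁻¹ •
        PiTensorProduct.map (fun _ : Fin n => phi fun i : Fin N => x (σ (Fin.castLE h' i)))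
          (chi n N) := by
  have key (τ : Equiv.Perm (Fin N)) :
      ∑ σ : Equiv.Perm (Fin N'), PiTensorProduct.tprod ℝ (fun i : Fin n =>
        (e (x (σ (Fin.castLE h' (τ (Fin.castLE h i))))) : EllOne m)) =
      ∑ σ : Equiv.Perm (Fin N'), PiTensorProduct.tprod ℝ (fun i : Fin n =>
        (e (x (σ (Fin.castLE (h.trans h') i))) : EllOne m)) := by
    have hτ (i : Fin N) : τ.viaFintypeEmbedding (Fin.castLEEmb h') (Fin.castLE h' i) =
        Fin.castLE h' (τ i) := τ.viaFintypeEmbedding_apply_image (Fin.castLEEmb h') i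
    rw [← Equiv.sum_comp (Equiv.mulRight (τ.viaFintypeEmbedding (Fin.castLEEmb h')))
      fun σ : Equiv.Perm (Fin N') => PiTensorProduct.tprod ℝ (fun i : Fin n =>
        (e (x (σ (Fin.castLE (h.trans h') i))) : EllOne m))]
    refine Finset.sum_congr rfl fun σ _ => congrArg _ (funext fun i => ?_)
    rw [← hτ]
    rfl
  have hN : (N.factorial : ℝ) ≠ 0 := by positivity
  rw [chi_eq_perm (h.trans h'), chi_eq_perm h, ← Finset.smul_sum]
  simp only [map_smul, map_sum, fun (y : Fin N → Fin m) (τ : Equiv.Perm (Fin N)) =>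
    map_phi_tprod_e y fun i : Fin n => τ (Fin.castLE h i), fun σ : Equiv.Perm (Fin N') =>
    map_phi_tprod_e x fun i : Fin n => σ (Fin.castLE (h.trans h') i)]
  rw [← Finset.smul_sum, Finset.sum_comm, Finset.sum_congr rfl fun τ _ => key τ, Finset.sum_const,
    Finset.card_univ, Fintype.card_perm, Fintype.card_fin, ← Nat.cast_smul_eq_nsmul ℝ,
    inv_smul_smul₀ hN]

/-- The tensor for `N'` is an average of tensors for `N`, and the norm is convex. -/
theorem kappaExtFin_anti {N' : ℕ} (hm : 1 ≤ m) (h : n ≤ N) (h' : N ≤ N') :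
    kappaExtFin n N' m ≤ kappaExtFin n N m := by
  have : Nonempty (Fin m) := ⟨⟨0, hm⟩⟩
  refine ciSup_le fun x => ?_
  rw [map_phi_chi_eq_average h h' x]
  refine (symPosNorm_sum_smul_le _ _ fun σ _ => nonempty_symPosCosts
    (map_mem_symTensors _ (chi_mem_symTensors n N))).trans ?_
  refine (Finset.sum_le_sum fun σ _ => mul_le_mul_of_nonneg_left
    (symPosNorm_map_phi_chi_le_kappaExtFin _) (abs_nonneg _)).trans (le_of_eq ?_)
  have hN : (N'.factorial : ℝ) ≠ 0 := by positivity
  rw [Finset.sum_const, Finset.card_univ, Fintype.card_perm, Fintype.card_fin, nsmul_eq_mul,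
    abs_of_nonneg (by positivity), mul_inv_cancel_left₀ hN]

end Chi

/-! ### Drawing with replacement -/

section Uniform

variable {n N m : ℕ}

/-- The distribution of the colour `x b` of a uniformly random `b`. -/
noncomputable def colourDistr (x : Fin N → Fin m) : EllOne m := (N : ℝ)⁻¹ • ∑ b, e (x b)

theorem colourDistr_apply (x : Fin N → Fin m) (j : Fin m) :
    colourDistr x j = (Fintype.card {b // x b = j} : ℝ) / N := by
  rw [colourDistr, PiLp.smul_apply, WithLp.ofLp_sum, Finset.sum_apply, smul_eq_mul, div_eq_inv_mul]
  simp only [e_apply]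
  rw [Finset.sum_boole, Fintype.card_subtype]
  simp only [eq_comm]

theorem colourDistr_mem (x : Fin N → Fin m) : colourDistr x ∈ posCone m := fun j => by
  rw [colourDistr_apply]; positivity

theorem sum_colourDistr (hN : 1 ≤ N) (x : Fin N → Fin m) : ∑ j, colourDistr x j = 1 := by
  have hN' : (N : ℝ) ≠ 0 := by positivity
  simp only [colourDistr_apply]
  rw [← Finset.sum_div, ← Nat.cast_sum, sum_card_fiber, Fintype.card_fin, div_self hN']

theorem norm_colourDistr (hN : 1 ≤ N) (x : Fin N → Fin m) : ‖colourDistr x‖ = 1 := by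
  rw [norm_eq_sum_of_mem (colourDistr_mem x), sum_colourDistr hN]

theorem coeff_tprod_colourDistr (x : Fin N → Fin m) (z : Fin n → Fin m) :
    coeff z (PiTensorProduct.tprod ℝ fun _ => colourDistr x) =
      ∏ j, ((Fintype.card {b // x b = j} : ℝ) / N) ^ Fintype.card {i // z i = j} := by
  rw [coeff_tprod, prod_comp_eq_prod_pow_card z fun j => colourDistr x j]
  simp only [colourDistr_apply]

theorem sum_coeff_tprod_colourDistr (hN : 1 ≤ N) (x : Fin N → Fin m) :
    ∑ z : Fin n → Fin m, coeff z (PiTensorProduct.tprod ℝ fun _ => colourDistr x) = 1 := by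
  rw [sum_coeff_tprod]
  simp [sum_colourDistr hN]

theorem symPosNorm_tprod_colourDistr_le (hN : 1 ≤ N) (x : Fin N → Fin m) :
    symPosNorm (posCone m) (PiTensorProduct.tprod ℝ fun _ : Fin n => colourDistr x) ≤ 1 := by
  simpa [norm_colourDistr hN] using symPosNorm_tprod_le (n := n) (colourDistr_mem x)

end Uniform

end PosTensor

namespace PosTensor

/-! ### Upper bounds -/

section UpperBounds

variable {n N m : ℕ}

theorem coeff_chi_le (z : Fin n → Fin N) : coeff z (chi n N) ≤ (N.descFactorial n : ℝ)⁻¹ := by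
  rw [chi, map_smul, map_sum, Fintype.card_embedding_eq, Fintype.card_fin, Fintype.card_fin,
    smul_eq_mul]
  refine mul_le_of_le_one_right (by positivity) ?_
  simp only [fun f : Fin n ↪ Fin N => coeff_tprod_e z f]
  by_cases hz : ∃ g : Fin n ↪ Fin N, ⇑g = z
  · obtain ⟨g, rfl⟩ := hz
    simp [DFunLike.coe_fn_eq]
  · push Not at hz
    simp [hz]

theorem sum_coeff_chi (h : n ≤ N) : ∑ z, coeff z (chi n N) = 1 := by
  have hid : (phi (id : Fin N → Fin N)) = LinearMap.id := by
    refine LinearMap.ext fun y => ?_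
    rw [phi_eq_sum]
    exact sum_apply_smul_e y
  have := sum_coeff_map_phi_chi h (id : Fin N → Fin N)
  rwa [hid, PiTensorProduct.map_id] at this

theorem kappaExt_le (hn : 1 ≤ n) (hN : (n : ℝ) * ((n : ℝ) - 1) / 2 < N) :
    kappaExt n N ≤ 1 + (n : ℝ) * ((n : ℝ) - 1) / (2 * (N : ℝ) - n * ((n : ℝ) - 1)) *
      (kappa n + 1) := by
  have hn' : (1 : ℝ) ≤ n := by exact_mod_cast hn
  have hN0 : (0 : ℝ) < N := lt_of_le_of_lt (by nlinarith) hN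
  have hN1 : 1 ≤ N := by exact_mod_cast hN0
  set t : ℝ := 2 * (N : ℝ) - n * ((n : ℝ) - 1) with ht
  have ht0 : 0 < t := by linarith
  have hD := pow_mul_le_descFactorial hN1 n
  rw [← ht] at hD
  have hD0 : (0 : ℝ) < N.descFactorial n :=
    pos_of_mul_pos_right (lt_of_lt_of_le (by positivity) hD) (by positivity)
  have hnN : n ≤ N := Nat.descFactorial_pos.1 (by exact_mod_cast hD0)
  set p : ℝ := N.descFactorial n / (N : ℝ) ^ n with hp
  have hp0 : 0 < p := by positivity
  have hpinv : p⁻¹ ≤ 1 + (n : ℝ) * ((n : ℝ) - 1) / t := by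
    have h1 : p⁻¹ ≤ 2 * N / t := by
      rw [hp, inv_div, div_le_div_iff₀ hD0 ht0]
      exact hD
    have h2 : 2 * (N : ℝ) / t = 1 + (n : ℝ) * ((n : ℝ) - 1) / t := by
      field_simp
      linarith
    linarith
  set M : TPow n (EllOne N) := PiTensorProduct.tprod ℝ fun _ => colourDistr (id : Fin N → Fin N)
    with hM
  -- The part of `M` carried by draws with a repetition: `p` scales `χ` so that it cancels `M`
  -- exactly on injective tuples.
  set R : TPow n (EllOne N) := M - p • chi n N with hR
  have hRsymm : R ∈ symTensors n (EllOne N) :=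
    Submodule.sub_mem _ (tprod_const_mem_symTensors _)
      (Submodule.smul_mem _ _ (chi_mem_symTensors n N))
  have hcoeffM (z : Fin n → Fin N) : coeff z M = ((N : ℝ) ^ n)⁻¹ := by
    rw [hM, coeff_tprod]
    simp [colourDistr_apply]
  have hRnonneg (z : Fin n → Fin N) : 0 ≤ coeff z R := by
    rw [hR, map_sub, map_smul, hcoeffM, smul_eq_mul, sub_nonneg]
    refine (mul_le_mul_of_nonneg_left (coeff_chi_le z) hp0.le).trans (le_of_eq ?_)
    rw [hp]
    field_simp
  have hRsum : ∑ z, |coeff z R| = 1 - p := by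
    simp only [fun z => abs_of_nonneg (hRnonneg z)]
    simp only [hR, map_sub, map_smul, smul_eq_mul, Finset.sum_sub_distrib, ← Finset.mul_sum,
      sum_coeff_chi hnN, mul_one]
    rw [hM, sum_coeff_tprod_colourDistr hN1]
  have hRnorm := symPosNorm_le_sum_abs_coeff hRsymm
  rw [hRsum] at hRnorm
  have hchi : chi n N = p⁻¹ • M + (-p⁻¹) • R := by
    rw [hR, smul_sub, smul_smul, neg_mul, inv_mul_cancel₀ hp0.ne', neg_smul]
    module
  have hne := nonempty_symPosCosts (tprod_const_mem_symTensors (n := n)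
    (colourDistr (id : Fin N → Fin N)))
  have hneR := nonempty_symPosCosts hRsymm
  have hpi : 0 < p⁻¹ := inv_pos.2 hp0
  calc kappaExt n N = symPosNorm (posCone N) (p⁻¹ • M + (-p⁻¹) • R) := by rw [kappaExt, hchi]
    _ ≤ |p⁻¹| * symPosNorm (posCone N) M + |-p⁻¹| * symPosNorm (posCone N) R :=
      (symPosNorm_add_le (nonempty_symPosCosts_smul _ hne) (nonempty_symPosCosts_smul _ hneR)).trans
        (add_le_add (symPosNorm_smul_le _ hne) (symPosNorm_smul_le _ hneR))
    _ ≤ p⁻¹ * 1 + p⁻¹ * (kappa n * (1 - p)) := by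
      rw [abs_neg, abs_of_pos hpi]
      gcongr
      exact symPosNorm_tprod_colourDistr_le hN1 _
    _ = 1 + (p⁻¹ - 1) * (kappa n + 1) := by field_simp; ring
    _ ≤ _ := by
      have := mul_le_mul_of_nonneg_right (sub_le_iff_le_add'.2 hpinv)
        (show 0 ≤ kappa n + 1 by linarith [kappa_nonneg n])
      linarith

/-- The total variation bound of Diaconis and Freedman for drawing with and without replacement
from a set with `m` colours. -/
theorem sum_abs_coeff_map_phi_chi_sub_le (hm : 1 ≤ m) (hN : 1 ≤ N) (h : n ≤ N)
    (x : Fin N → Fin m) :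
    ∑ z, |coeff z (PiTensorProduct.map (fun _ : Fin n => phi x) (chi n N) -
      PiTensorProduct.tprod ℝ fun _ => colourDistr x)| ≤ 2 * m * n / N := by
  have : Nonempty (Fin m) := ⟨⟨0, hm⟩⟩
  have hN0 : (0 : ℝ) < N := by exact_mod_cast hN
  have hD0 : (0 : ℝ) < N.descFactorial n := by exact_mod_cast Nat.descFactorial_pos.2 h
  set H : (Fin n → Fin m) → ℝ := fun z =>
    coeff z (PiTensorProduct.map (fun _ : Fin n => phi x) (chi n N)) with hH
  set M : (Fin n → Fin m) → ℝ := fun z =>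
    coeff z (PiTensorProduct.tprod ℝ fun _ => colourDistr x) with hM
  set q : ℝ := (1 - (n : ℝ) / N) ^ m with hq
  have hnN : (n : ℝ) / N ≤ 1 := (div_le_one hN0).2 (by exact_mod_cast h)
  have hq1 : q ≤ 1 := pow_le_one₀ (by linarith) (by linarith [show (0 : ℝ) ≤ (n : ℝ) / N by positivity])
  have hqB : 1 - q ≤ m * n / N := by
    have := one_add_mul_le_pow (a := -((n : ℝ) / N)) (by linarith) m
    rw [hq, mul_div_assoc, sub_eq_add_neg 1 ((n : ℝ) / N)]
    linarith
  have hH0 (z) : 0 ≤ H z := by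
    rw [hH]
    simp only [coeff_map_phi_chi]
    positivity
  have hqHM (z) : q * H z ≤ M z := by
    have key := prod_descFactorial_le (fun j => Fintype.card {i // z i = j})
      (fun j => Fintype.card {b // x b = j})
    simp only [sum_card_fiber, Fintype.card_fin] at key
    simp only [hH, hM, coeff_map_phi_chi, coeff_tprod_colourDistr, div_pow]
    rw [Finset.prod_div_distrib, Finset.prod_pow_eq_pow_sum, sum_card_fiber, Fintype.card_fin,
      le_div_iff₀ (by positivity)]
    refine le_of_mul_le_mul_left ?_ hD0
    refine le_trans (le_of_eq ?_) key
    rw [← hq]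
    field_simp
  -- Since `q H ≤ M`, the positive part of `H - M` is at most `(1 - q) H`; then `|t| = 2 t⁺ - t`.
  -- The last term sums to zero, as both distributions have mass 1.
  have hpt (z) : |H z - M z| ≤ 2 * (1 - q) * H z - (H z - M z) := by
    rw [abs_le]
    constructor
    · nlinarith [hH0 z]
    · nlinarith [hqHM z]
  simp only [map_sub]
  calc ∑ z, |H z - M z| ≤ ∑ z, (2 * (1 - q) * H z - (H z - M z)) :=
        Finset.sum_le_sum fun z _ => hpt z
    _ = 2 * (1 - q) := by
        rw [Finset.sum_sub_distrib, Finset.sum_sub_distrib, ← Finset.mul_sum,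
          sum_coeff_map_phi_chi h, sum_coeff_tprod_colourDistr hN]
        ring
    _ ≤ 2 * (m * n / N) := by linarith
    _ = _ := by ring

theorem kappaExtFin_le (hm : 1 ≤ m) (hN : 1 ≤ N) (h : n ≤ N) :
    kappaExtFin n N m ≤ 1 + posPolConst (posCone m) n * (2 * m * n / N) := by
  have : Nonempty (Fin m) := ⟨⟨0, hm⟩⟩
  refine ciSup_le fun x => ?_
  set H := PiTensorProduct.map (fun _ : Fin n => phi x) (chi n N)
  set M : TPow n (EllOne m) := PiTensorProduct.tprod ℝ fun _ => colourDistr x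
  have hM : M ∈ symTensors n (EllOne m) := tprod_const_mem_symTensors _
  have hHM : H - M ∈ symTensors n (EllOne m) :=
    Submodule.sub_mem _ (map_mem_symTensors _ (chi_mem_symTensors n N)) hM
  rw [← add_sub_cancel M H]
  refine (symPosNorm_add_le (nonempty_symPosCosts hM) (nonempty_symPosCosts hHM)).trans ?_
  refine add_le_add (symPosNorm_tprod_colourDistr_le hN x) ?_
  exact (symPosNorm_le_posPolConst_mul hHM).trans (mul_le_mul_of_nonneg_left
    (sum_abs_coeff_map_phi_chi_sub_le hm hN h x) posPolConst_nonneg)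

end UpperBounds

/-! ### Lower bounds by duality -/

section LowerBounds

variable {n N m : ℕ}

/-- The maximum of a monomial on the simplex. -/
theorem prod_apply_le (hn : 1 ≤ n) (c : Fin n → Fin m) {y : EllOne m} (hy : y ∈ posCone m) :
    ∏ i, y (c i) ≤ (∏ j, ((Fintype.card {i // c i = j} : ℝ) / n) ^
      Fintype.card {i // c i = j}) * ‖y‖ ^ n := by
  have hn0 : (0 : ℝ) < n := by exact_mod_cast hn
  set w : Fin m → ℝ := fun j => Fintype.card {i // c i = j} with hw
  have hw0 (i : Fin n) : 0 < w (c i) := by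
    have : Nonempty {i' // c i' = c i} := ⟨⟨i, rfl⟩⟩
    simp only [hw]
    exact_mod_cast Fintype.card_pos
  -- Dividing by the coordinates `w/n` of the maximizer turns the claim into AM-GM with equal
  -- weights; the mean of `Z` is the sum of `y` over the colours that occur.
  set Z : Fin n → ℝ := fun i => y (c i) / (w (c i) / n) with hZ
  have hZ0 (i) : 0 ≤ Z i := div_nonneg (hy _) (div_nonneg (hw0 i).le hn0.le)
  have hsum : ∑ i, (1 / (n : ℝ)) * Z i ≤ ‖y‖ := by
    have e (i) : (1 / (n : ℝ)) * Z i = y (c i) / w (c i) := by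
      simp only [hZ]
      have := hw0 i
      field_simp
    rw [Finset.sum_congr rfl fun i _ => e i, norm_eq_sum_of_mem hy,
      ← Finset.sum_fiberwise' Finset.univ c fun j => y j / w j]
    refine Finset.sum_le_sum fun j _ => ?_
    rw [Finset.sum_const, ← Fintype.card_subtype, nsmul_eq_mul]
    rcases eq_or_ne (w j) 0 with h0 | h0
    · rw [h0, div_zero, mul_zero]
      exact hy j
    · exact (mul_div_cancel₀ _ h0).le
  have hamgm := Real.geom_mean_le_arith_mean_weighted Finset.univ (fun _ : Fin n => 1 / (n : ℝ)) Z
    (fun _ _ => by positivity) (by simp [hn0.ne']) fun i _ => hZ0 i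
  have hpow : ∏ i, Z i ≤ ‖y‖ ^ n := by
    have h1 := pow_le_pow_left₀ (Finset.prod_nonneg fun i _ => Real.rpow_nonneg (hZ0 i) _)
      (hamgm.trans hsum) n
    rw [← Finset.prod_pow] at h1
    refine le_trans (le_of_eq (Finset.prod_congr rfl fun i _ => ?_)) h1
    rw [← Real.rpow_natCast, ← Real.rpow_mul (hZ0 i), one_div_mul_cancel hn0.ne', Real.rpow_one]
  rw [← prod_comp_eq_prod_pow_card c fun j => w j / n]
  calc ∏ i, y (c i) = (∏ i, w (c i) / n) * ∏ i, Z i := by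
        rw [← Finset.prod_mul_distrib]
        refine Finset.prod_congr rfl fun i _ => ?_
        have := hw0 i
        simp only [hZ]
        field_simp
    _ ≤ _ := mul_le_mul_of_nonneg_left hpow
        (Finset.prod_nonneg fun i _ => div_nonneg (hw0 i).le hn0.le)

/-- The population has the same colour proportions as the sample `c`, so the multinomial probability
of `c` is exactly the maximum `B` of the monomial. The bound is the ratio of the hypergeometric
probability to `B`. -/
theorem prod_fallingRatio_div_le_kappaExtFin {k : ℕ} (hk : 1 ≤ k) (hn : 1 ≤ n)
    (c : Fin n → Fin m) :
    (∏ j, fallingRatio k (Fintype.card {i // c i = j})) / fallingRatio k n ≤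
      kappaExtFin n (n * k) m := by
  have hn0 : (0 : ℝ) < n := by exact_mod_cast hn
  have hk0 : (0 : ℝ) < k := by exact_mod_cast hk
  set x : Fin (n * k) → Fin m := fun b => c (finProdFinEquiv.symm b).1 with hx
  have hcard (j : Fin m) : Fintype.card {b // x b = j} = k * Fintype.card {i // c i = j} := by
    rw [Fintype.card_congr ((finProdFinEquiv.symm.subtypeEquiv fun b => Iff.rfl :
      {b // x b = j} ≃ {p : Fin n × Fin k // c p.1 = j}).trans
        (Equiv.prodSubtypeFstEquivSubtypeProd (p := fun i => c i = j))), Fintype.card_prod,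
      Fintype.card_fin, mul_comm]
  refine le_trans ?_ (symPosNorm_map_phi_chi_le_kappaExtFin x)
  set B : ℝ := ∏ j, ((Fintype.card {i // c i = j} : ℝ) / n) ^ Fintype.card {i // c i = j} with hB
  have hB0 : 0 < B := by
    refine Finset.prod_pos fun j _ => ?_
    rcases Nat.eq_zero_or_pos (Fintype.card {i // c i = j}) with h0 | h0
    · simp [h0]
    · positivity
  have hdual := apply_le_mul_symPosNorm (P := posCone m) (coeff c) hB0 (fun y hy => by
    rw [coeff_tprod, abs_of_nonneg (Finset.prod_nonneg fun i _ => hy (c i))]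
    exact prod_apply_le hn c hy) (nonempty_symPosCosts (map_mem_symTensors (phi x)
      (chi_mem_symTensors n (n * k))))
  refine le_of_mul_le_mul_left (le_trans (le_of_eq ?_) hdual) hB0
  rw [coeff_map_phi_chi]
  simp only [hcard, mul_comm n k, descFactorial_eq_fallingRatio hk]
  rw [Finset.prod_mul_distrib]
  have e1 : ∏ j, ((k : ℝ) * Fintype.card {i // c i = j}) ^ Fintype.card {i // c i = j} =
      B * (k * n : ℝ) ^ n := by
    have : (k * n : ℝ) ^ n = ∏ j, (k * n : ℝ) ^ Fintype.card {i // c i = j} := by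
      rw [Finset.prod_pow_eq_pow_sum, sum_card_fiber, Fintype.card_fin]
    rw [hB, this, ← Finset.prod_mul_distrib]
    refine Finset.prod_congr rfl fun j _ => ?_
    rw [← mul_pow]
    congr 1
    field_simp
  rw [e1]
  have := fallingRatio_pos hk n
  field_simp

theorem exp_le_kappaExtFin_mul {k : ℕ} (hk : 1 ≤ k) (hm : 1 ≤ m) (hmn : m ≤ n) :
    Real.exp (((m : ℝ) - 1) / (2 * k)) ≤ kappaExtFin n (n * k) m := by
  obtain ⟨d, rfl⟩ : ∃ d, m = d + 1 := ⟨m - 1, by omega⟩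
  obtain ⟨s, rfl⟩ : ∃ s, n = s + d := ⟨n - d, by omega⟩
  -- The first `d` colours occur once and the last one `s = n - m + 1` times. Since `F(k,1) = 1`,
  -- only `F(k,s) / F(k,s+d)` remains.
  set c : Fin (s + d) → Fin (d + 1) := fun i => ⟨min i d, by omega⟩ with hc
  have hone (j : Fin d) : Fintype.card {i // c i = j.castSucc} = 1 := by
    rw [Fintype.card_eq_one_iff]
    refine ⟨⟨⟨j, by omega⟩, ?_⟩, ?_⟩
    · ext
      simp only [hc, Fin.val_castSucc]
      omega
    · rintro ⟨i, hi⟩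
      have := congrArg Fin.val hi
      simp only [hc, Fin.val_castSucc] at this
      ext
      simp only
      omega
  have hlast : Fintype.card {i // c i = Fin.last d} = s := by
    have := sum_card_fiber c
    rw [Fin.sum_univ_castSucc] at this
    simp only [hone, Fintype.card_fin, Finset.sum_const, Finset.card_univ, smul_eq_mul] at this
    omega
  refine le_trans ?_ (prod_fallingRatio_div_le_kappaExtFin hk (by omega) c)
  rw [Fin.prod_univ_castSucc]
  simp only [hone, hlast]
  rw [le_div_iff₀ (fallingRatio_pos hk _)]
  have := exp_mul_fallingRatio_le hk (show 1 ≤ s by omega) d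
  simpa [fallingRatio] using this

theorem exp_le_kappaExtFin (hm : 1 ≤ m) (hmn : m ≤ n) (hnN : n ≤ N) :
    Real.exp (((m : ℝ) - 1) / (2 * (⌈(N : ℝ) / n⌉₊ : ℝ))) ≤ kappaExtFin n N m := by
  have hn0 : (0 : ℝ) < n := by exact_mod_cast (show 0 < n by omega)
  have hN0 : (0 : ℝ) < N := by exact_mod_cast (show 0 < N by omega)
  have hk : 1 ≤ ⌈(N : ℝ) / n⌉₊ := Nat.ceil_pos.2 (by positivity)
  -- Rounding `N` up to the multiple `n ⌈N/n⌉` can only lower `κ`.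
  refine (exp_le_kappaExtFin_mul hk hm hmn).trans (kappaExtFin_anti hm hnN ?_)
  have := Nat.le_ceil ((N : ℝ) / n)
  rw [div_le_iff₀' hn0] at this
  exact_mod_cast this

theorem one_add_le_exp_ceil (hm : 1 ≤ m) (hn : 1 ≤ n) (hN : 1 ≤ N) :
    1 + ((m : ℝ) - 1) * n / (2 * ((N : ℝ) + n)) ≤
      Real.exp (((m : ℝ) - 1) / (2 * (⌈(N : ℝ) / n⌉₊ : ℝ))) := by
  have hn0 : (0 : ℝ) < n := by exact_mod_cast hn
  have hN0 : (0 : ℝ) < N := by exact_mod_cast hN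
  have hm0 : (0 : ℝ) ≤ (m : ℝ) - 1 := sub_nonneg.2 (by exact_mod_cast hm)
  have hk : (0 : ℝ) < ⌈(N : ℝ) / n⌉₊ := by exact_mod_cast Nat.ceil_pos.2 (by positivity)
  have hk' : (n : ℝ) * ⌈(N : ℝ) / n⌉₊ ≤ N + n := by
    have := Nat.ceil_lt_add_one (show 0 ≤ (N : ℝ) / n by positivity)
    have := mul_le_mul_of_nonneg_left this.le hn0.le
    rwa [mul_add, mul_div_cancel₀ _ hn0.ne', mul_one] at this
  refine le_trans ?_ (Real.add_one_le_exp _)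
  rw [add_comm, mul_div_assoc, div_eq_mul_inv (_ - _)]
  gcongr
  rw [inv_eq_one_div, div_le_div_iff₀ (by positivity) (by positivity)]
  linarith

end LowerBounds

/-! ### Consequences for `κ(n,N)` and its asymptotics -/

theorem exp_le_kappaExt {n N : ℕ} (hn : 1 ≤ n) (h : n ≤ N) :
    Real.exp (((n : ℝ) - 1) / (2 * (⌈(N : ℝ) / n⌉₊ : ℝ))) ≤ kappaExt n N :=
  (exp_le_kappaExtFin hn le_rfl h).trans (kappaExtFin_le_kappaExt hn)

theorem one_add_le_kappaExt {n N : ℕ} (hn : 1 ≤ n) (h : n ≤ N) :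
    1 + (n : ℝ) * ((n : ℝ) - 1) / (2 * ((N : ℝ) + n)) ≤ kappaExt n N := by
  rw [mul_comm (n : ℝ)]
  exact (one_add_le_exp_ceil hn hn (hn.trans h)).trans (exp_le_kappaExt hn h)

theorem isTheta_kappaExt_sub_one {n : ℕ} (hn : 2 ≤ n) :
    Asymptotics.IsTheta Filter.atTop (fun N : ℕ => kappaExt n N - 1)
      (fun N : ℕ => 1 / (N : ℝ)) := by
  have hn0 : (2 : ℝ) ≤ n := by exact_mod_cast hn
  have hκ := kappa_nonneg n
  have hc : 0 ≤ (n : ℝ) * (n - 1) := by nlinarith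
  constructor
  · refine Asymptotics.IsBigO.of_bound ((n : ℝ) * (n - 1) * (kappa n + 1)) ?_
    -- For `N ≥ n²` the denominator `2N - n(n-1)` is at least `N`.
    filter_upwards [Filter.eventually_ge_atTop (n * n)] with N hN
    have hN' : (n : ℝ) * n ≤ N := by exact_mod_cast hN
    have hN0 : (0 : ℝ) < N := by nlinarith
    have h1 := kappaExt_le (n := n) (N := N) (by omega) (by nlinarith)
    have h2 := one_add_le_kappaExt (n := n) (N := N) (by omega) (by nlinarith)
    have h3 : 0 ≤ (n : ℝ) * ((n : ℝ) - 1) / (2 * ((N : ℝ) + n)) := by positivity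
    rw [Real.norm_of_nonneg (by linarith), Real.norm_of_nonneg (by positivity)]
    have h4 : (n : ℝ) * ((n : ℝ) - 1) / (2 * (N : ℝ) - n * ((n : ℝ) - 1)) ≤
        (n : ℝ) * (n - 1) / N := div_le_div_of_nonneg_left hc hN0 (by nlinarith)
    have h5 := mul_le_mul_of_nonneg_right h4 (show 0 ≤ kappa n + 1 by linarith)
    calc kappaExt n N - 1 ≤ (n : ℝ) * (n - 1) / N * (kappa n + 1) := by linarith
      _ = _ := by ring
  -- The constant 4 is not sharp: `n(n-1) ≥ 2` and `N + n ≤ 2N` already give a lower bound `1/(2N)`.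
  · refine Asymptotics.IsBigO.of_bound 4 ?_
    filter_upwards [Filter.eventually_ge_atTop n] with N hN
    have hN' : (n : ℝ) ≤ N := by exact_mod_cast hN
    have hN0 : (0 : ℝ) < N := by linarith
    have h2 := one_add_le_kappaExt (n := n) (N := N) (by omega) hN
    have h3 : 1 / (4 * N) ≤ (n : ℝ) * ((n : ℝ) - 1) / (2 * ((N : ℝ) + n)) := by
      rw [div_le_div_iff₀ (by positivity) (by positivity)]
      have := mul_le_mul_of_nonneg_right (show (2 : ℝ) ≤ n * (n - 1) by nlinarith) hN0.le
      linarith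
    have h4 : 0 ≤ 1 / (4 * (N : ℝ)) := by positivity
    rw [Real.norm_of_nonneg (by positivity), Real.norm_of_nonneg (by linarith)]
    have h5 : 1 / (N : ℝ) = 4 * (1 / (4 * N)) := by field_simp
    linarith

end PosTensor
theorem theorem7p3 :
    -- every symmetric tensor over `ℓ₁ᵐ` has a decomposition, and `c_{π,s+}(n, ℓ₁ᵐ)` is finite
    (∀ n m : ℕ, 1 ≤ n → 1 ≤ m →
      (∀ x ∈ PosTensor.symTensors n (PosTensor.EllOne m),
        (PosTensor.symPosCosts (PosTensor.posCone m) x).Nonempty) ∧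
      BddAbove (Set.range (PosTensor.posRatio (PosTensor.posCone m) n))) ∧
    (∀ n N : ℕ, 1 ≤ n → (n : ℝ) * ((n : ℝ) - 1) / 2 < (N : ℝ) →
      PosTensor.kappaExt n N ≤
        1 + (n : ℝ) * ((n : ℝ) - 1) / (2 * (N : ℝ) - (n : ℝ) * ((n : ℝ) - 1))
          * (PosTensor.kappa n + 1)) ∧
    (∀ n N : ℕ, 1 ≤ n → n ≤ N →
      Real.exp (((n : ℝ) - 1) / (2 * (⌈(N : ℝ) / (n : ℝ)⌉₊ : ℝ))) ≤ PosTensor.kappaExt n N ∧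
      1 + (n : ℝ) * ((n : ℝ) - 1) / (2 * ((N : ℝ) + (n : ℝ))) ≤
        Real.exp (((n : ℝ) - 1) / (2 * (⌈(N : ℝ) / (n : ℝ)⌉₊ : ℝ)))) ∧
    (∀ n N m : ℕ, 1 ≤ m → m ≤ n → n ≤ N →
      PosTensor.kappaExtFin n N m ≤
        1 + PosTensor.posPolConst (PosTensor.posCone m) n
          * (2 * (m : ℝ) * (n : ℝ) / (N : ℝ)) ∧
      1 + PosTensor.posPolConst (PosTensor.posCone m) n
          * (2 * (m : ℝ) * (n : ℝ) / (N : ℝ)) ≤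
        1 + 2 * (m : ℝ) * (n : ℝ) * PosTensor.kappa n / (N : ℝ)) ∧
    (∀ n N m : ℕ, 1 ≤ m → m ≤ n → n ≤ N →
      Real.exp (((m : ℝ) - 1) / (2 * (⌈(N : ℝ) / (n : ℝ)⌉₊ : ℝ))) ≤
        PosTensor.kappaExtFin n N m ∧
      1 + ((m : ℝ) - 1) * (n : ℝ) / (2 * ((N : ℝ) + (n : ℝ))) ≤
        Real.exp (((m : ℝ) - 1) / (2 * (⌈(N : ℝ) / (n : ℝ)⌉₊ : ℝ)))) ∧
    -- `κ(n,N) = 1 + Θ(1/N)` as `N → ∞` for fixed `n ≥ 2`; for `n = 1`, `κ(1,N) = 1`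
    (∀ n : ℕ, 2 ≤ n →
      Asymptotics.IsTheta Filter.atTop (fun N : ℕ => PosTensor.kappaExt n N - 1)
        (fun N : ℕ => 1 / (N : ℝ))) ∧
    (∀ N : ℕ, 1 ≤ N → PosTensor.kappaExt 1 N = 1) := by

  refine ⟨fun n m _ _ => ⟨fun x hx => PosTensor.nonempty_symPosCosts hx,
    PosTensor.bddAbove_range_posRatio⟩, fun n N hn hN => PosTensor.kappaExt_le hn hN,
    fun n N hn h => ⟨PosTensor.exp_le_kappaExt hn h, ?_⟩, fun n N m hm hmn hnN =>
      ⟨PosTensor.kappaExtFin_le hm (hm.trans (hmn.trans hnN)) hnN, ?_⟩, fun n N m hm hmn hnN =>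
      ⟨PosTensor.exp_le_kappaExtFin hm hmn hnN, PosTensor.one_add_le_exp_ceil hm (hm.trans hmn)
        (hm.trans (hmn.trans hnN))⟩, fun n hn => PosTensor.isTheta_kappaExt_sub_one hn,
    fun N hN => le_antisymm ?_ ?_⟩
  · rw [mul_comm (n : ℝ)]
    exact PosTensor.one_add_le_exp_ceil hn hn (hn.trans h)
  · have h : PosTensor.posPolConst (PosTensor.posCone m) n * (2 * (m : ℝ) * n / N) ≤
        PosTensor.kappa n * (2 * (m : ℝ) * n / N) :=
      mul_le_mul_of_nonneg_right PosTensor.posPolConst_le_kappa (by positivity)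
    refine add_le_add_right (h.trans (le_of_eq ?_)) 1
    ring
  · have hN' : (0 : ℝ) < N := by exact_mod_cast hN
    simpa using PosTensor.kappaExt_le (n := 1) (N := N) le_rfl (by simpa using hN')
  · simpa using PosTensor.one_add_le_kappaExt (n := 1) (N := N) le_rfl hN
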